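/- For integers $n\ge 1$ let $G(n,3)$ be the generalized Petersen (multi)graph with vertices $v_i,w_i$ and edges $v_iv_{i+1}$, $w_iw_{i+3}$, $v_iw_i$ ($0\le i<n$, indices modulo $n$; for small $n$ loops and parallel edges can occur, and parallel edges are distinguished). A Hamiltonian cycle is a closed walk visiting each of the $2n$ vertices exactly once, and two such walks are identified when they have the same edge set; in particular, for $n=1$ the closed walk $v_0w_0v_0$ counts as one Hamiltonian cycle. Let $h_3(n)$ be the number of Hamiltonian cycles of $G(n,3)$. Call an edge $v_iv_{i+1}$ with $0\le i<n$, $i+1\ge n$, or $w_iw_{i+3}$ with $0\le i<n$, $i+3\ge n$, a seam edge (for $n\ge 3$ these are the four edges $v_{n-1}v_0$, $w_{n-3}w_0$, $w_{n-2}w_1$, $w_{n-1}w_2$). Cutting the seam edges used by a Hamiltonian cycle leaves one loose end on each side per cut edge. Let $h_3^{(e)}(n)$ and $h_3^{(o)}(n)$ be the numbers of Hamiltonian cycles of $G(n,3)$ with an even, respectively odd, number of seam edges, i.e. of loose ends on each side. Let $u^{(e)}_n=2$ if $n\equiv 2\pmod 4$ and $u^{(e)}_n=0$ otherwise; let $u^{(o)}_n=-12$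 if $n\equiv 0\pmod{12}$, $u^{(o)}_n=4$ if $n\equiv 4$ or $8\pmod{12}$, and $u^{(o)}_n=0$ otherwise. Put $$h_3^{(\alpha)}(n)=h_3^{(e)}(n)-u^{(e)}_n,\qquad h_3^{(\beta)}(n)=h_3^{(o)}(n)-u^{(o)}_n,\qquad h_3^{(\gamma)}(n)=u^{(e)}_n+u^{(o)}_n .$$ Say that a monic polynomial $p(x)=x^d+p_{d-1}x^{d-1}+\dots+p_0$ is a characteristic polynomial for $(u_n)_{n\ge1}$ for $n\ge n_0$ if $u_n+p_{d-1}u_{n-1}+\dots+p_0u_{n-d}=0$ for all $n\ge n_0$. Proposition. For all $n\ge 1$, $h_3(n)=h_3^{(\alpha)}(n)+h_3^{(\beta)}(n)+h_3^{(\gamma)}(n)$, where 1. the values of $h_3^{(\alpha)}(n)$ for $1\le n\le 12$ are $1,0,0,0,0,6,7,0,9,10,11,36$, and $(x^6-x^3-x-1)^2$ is a characteristic polynomial for $h_3^{(\alpha)}$ for $n\ge 13$; 2. the values of $h_3^{(\beta)}(n)$ for $1\le n\le 14$ are $0,2,0,2,0,8,0,2,0,12,0,44,0,58$, and $x^{14}-x^{12}-x^8+x^6-x^4-2x^2-1$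 is a characteristic polynomial for $h_3^{(\beta)}$ for $n\ge 15$; 3. $h_3^{(\gamma)}$ is periodic with period $12$, with the terms $0,2,0,4,0,2,0,4,0,2,0,-12$ repeating from $n=1$. -/

import Mathlib

open Polynomial

namespace GenPetersen

/-- Vertices `v_i`, `w_i` (indices modulo `n`) of the generalized Petersen graph `G(n, k)`. -/
inductive Vertex (n : ℕ) where
  | v (i : ZMod n)
  | w (i : ZMod n)

/-- Edges of `G(n, k)`, regarded as a multigraph: `outer i` is `v_i v_{i+1}`, `inner i` is
`w_i w_{i+k}`, `spoke i` is `v_i w_i`. For small `n` there can be loops and parallel edges. -/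
inductive Edge (n : ℕ) where
  | outer (i : ZMod n)
  | inner (i : ZMod n)
  | spoke (i : ZMod n)

/-- The unordered pair of end points of an edge of `G(n, k)`. -/
def ends {n : ℕ} (k : ℕ) : Edge n → Sym2 (Vertex n)
  | .outer i => s(.v i, .v (i + 1))
  | .inner i => s(.w i, .w (i + (k : ZMod n)))
  | .spoke i => s(.v i, .w i)

/-- `C` is the edge set of a Hamiltonian cycle of `G(n, k)`: a closed walk that visits each of the
`2n` vertices exactly once. The walk is `x 0, e 0, x 1, e 1, …`, with indices modulo `2n`.
Walks that differ by a rotation or a reversal have the same edge set, so that they give one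
Hamiltonian cycle; parallel edges are distinguished. For `n = 1` the closed walk `v_0 w_0 v_0` is
a Hamiltonian cycle; for `n ≥ 2` the edges of such a walk are automatically distinct. -/
def IsHamiltonianCycle (n k : ℕ) (C : Set (Edge n)) : Prop :=
  ∃ (x : ZMod (2 * n) → Vertex n) (e : ZMod (2 * n) → Edge n),
    Function.Bijective x ∧ (∀ i, ends k (e i) = s(x i, x (i + 1))) ∧ Set.range e = C

/-- The number `h_k(n)` of Hamiltonian cycles of `G(n, k)`. -/
noncomputable def h (k n : ℕ) : ℕ :=
  {C : Set (Edge n) | IsHamiltonianCycle n k C}.ncard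

/-- The edges of `G(n, k)` that pass from the index `n - 1` to the index `0`. For `n ≥ k` these are
`v_{n-1} v_0`, `w_{n-k} w_0`, …, `w_{n-1} w_{k-1}`, the edges that are cut open in `G'(n, k)`. -/
def seam (n k : ℕ) : Set (Edge n) :=
  {a | match a with
    | .outer i => n ≤ i.val + 1
    | .inner i => n ≤ i.val + k
    | .spoke _ => False}

/-- The number of loose ends on each side (`L_0, …, L_k` on the left, `R_0, …, R_k` on the right)
of the admissible subgraph of `G'(n, k)` obtained by cutting the Hamiltonian cycle `C` open: each
seam edge that is used gives one loose end on either side. -/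
noncomputable def looseEnds {n : ℕ} (k : ℕ) (C : Set (Edge n)) : ℕ := (C ∩ seam n k).ncard

/-- `h_k^{(e)}(n)`: Hamiltonian cycles with an even number of loose ends on each side. -/
noncomputable def hEven (k n : ℕ) : ℕ :=
  {C : Set (Edge n) | IsHamiltonianCycle n k C ∧ Even (looseEnds k C)}.ncard

/-- `h_k^{(o)}(n)`: Hamiltonian cycles with an odd number of loose ends on each side. -/
noncomputable def hOdd (k n : ℕ) : ℕ :=
  {C : Set (Edge n) | IsHamiltonianCycle n k C ∧ Odd (looseEnds k C)}.ncard

/-- The periodic function `u^{(e)}`. -/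
def uEven (n : ℕ) : ℤ := if n % 4 = 2 then 2 else 0

/-- The periodic function `u^{(o)}`. -/
def uOdd (n : ℕ) : ℤ :=
  if n % 12 = 0 then -12 else if n % 12 = 4 ∨ n % 12 = 8 then 4 else 0

/-- `h_3^{(α)}`. -/
noncomputable def hAlpha (n : ℕ) : ℤ := (hEven 3 n : ℤ) - uEven n

/-- `h_3^{(β)}`. -/
noncomputable def hBeta (n : ℕ) : ℤ := (hOdd 3 n : ℤ) - uOdd n

/-- `h_3^{(γ)}`. -/
def hGamma (n : ℕ) : ℤ := uEven n + uOdd n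

/-- The monic polynomial `p = x^d + p_{d-1} x^{d-1} + … + p_0` is a characteristic polynomial for
the sequence `u` for `n ≥ n₀`, i.e. `u_n + p_{d-1} u_{n-1} + … + p_0 u_{n-d} = 0` for all
`n ≥ n₀`. The indices are written as `n = m + d`. -/
def IsCharPolyFrom (p : ℤ[X]) (u : ℕ → ℤ) (n₀ : ℕ) : Prop :=
  p.Monic ∧ ∀ m : ℕ, n₀ ≤ m + p.natDegree →
    ∑ j ∈ Finset.range (p.natDegree + 1), p.coeff j * u (m + j) = 0

/-- `P^{(7)}`. -/
noncomputable def P7 : ℤ[X] := X ^ 6 - X ^ 3 - X - 1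

/-- `P^{(8)}`. -/
noncomputable def P8 : ℤ[X] :=
  X ^ 14 - X ^ 12 - X ^ 8 + X ^ 6 - X ^ 4 - 2 * X ^ 2 - 1

end GenPetersen

/-! A Hamiltonian cycle is a two-factor that cannot be split: a loopless edge set `C` with two edges
at every vertex, such that the only subsets of `C` containing all or none of its edges at each
vertex are `∅` and `C`. These subsets are the unions of components, so connectedness becomes a
count: there are exactly two sub-selections. Degree and closedness are conditions at single vertices
(`isHamiltonianCycle_edgeSet`), hence a transfer automaton can check them.

An edge set is a cyclic word whose letter at `i` tells which of the outer edge, the inner edge and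
the spoke indexed by `i` are present. The conditions at `v_i`, `w_i` involve only this letter and
the window of the four edges that pass from earlier indices to `i` or beyond. A state keeps the
start window, the present window and the multiset of boundary codes of the sub-selections of the
prefix; this decides which continuations close up with exactly two sub-selections. The window at
index `0` consists of the seam edges, so the parity of the loose ends is a choice of start windows
(`hEven_eq_total`, `hOdd_eq_total`). The lengths `1`, `2`, `3` are degenerate and are treated
separately.

One step of the automaton is linear on formal combinations of states and corresponds to shifting the
counting sequence (`total_adv`). If a polynomial in this step sends an initial state to the zero
combination, the recurrence with that characteristic polynomial holds for all lengths
(`total_combine`). A finite computation confirms this for `x⁴ (x¹² - 1) p`, with `p = P7²` for even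
and `p = P8` for odd start windows. The factor `x¹² - 1` kills the periodic corrections;
`combination_eq_zero_of_periodic` cancels it, given the first instances of the recurrence for `p`,
which are read off a table of values. -/

namespace GenPetersen

/-! ### The transfer automaton, on numerical codes -/

/-- The window obtained from the window `W` by adding the letter `a`. -/
def push (W a : ℕ) : ℕ := a % 2 + 2 * (W / 4) + 8 * (a / 2 % 2)

/-- The code of the three edges at an outer vertex. -/
def outerCode (W a : ℕ) : ℕ := W % 2 + 2 * (a % 2) + 4 * (a / 4)

/-- The code of the three edges at an inner vertex. -/
def innerCode (W a : ℕ) : ℕ := W / 2 % 2 + 2 * (a / 2 % 2) + 4 * (a / 4)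

/-- Exactly two of three bits are set. -/
def isTwo (c : ℕ) : Bool := Nat.beq c 3 || Nat.beq c 5 || Nat.beq c 6

/-- Both vertices have degree two. -/
def degOK (W a : ℕ) : Bool := isTwo (outerCode W a) && isTwo (innerCode W a)

/-- At both vertices, `(x, g)` selects all or none of the edges that `(W, a)` selects. -/
def subOK (W a x g : ℕ) : Bool :=
  (Nat.beq (outerCode x g) 0 || Nat.beq (outerCode x g) (outerCode W a)) &&
  (Nat.beq (innerCode x g) 0 || Nat.beq (innerCode x g) (innerCode W a))

/-- The codes of all letters: bit 0 for `outer i`, bit 1 for `inner i`, bit 2 for `spoke i`. -/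
def letters : List ℕ := [0, 1, 2, 3, 4, 5, 6, 7]

/-- The letters `a` with `degOK W a`. -/
def nextLetters (W : ℕ) : List ℕ :=
  match W % 4 with
  | 0 => [7]
  | 1 => [6]
  | 2 => [5]
  | _ => [3, 4]

/-- The letters `g` with `subOK W a x g`, if `a` is one of the letters allowed after `W`. -/
def subLetters (a x : ℕ) : List ℕ :=
  -- An allowed letter determines `W % 4`: the letters 3 and 4 occur only after 3, and 5, 6, 7 only
  -- after 2, 1, 0. Hence `W` itself is not needed.
  match a with
  | 3 => [x % 4]
  | 4 => match x % 4 with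
    | 0 => [0]
    | 3 => [4]
    | _ => []
  | 5 => match x % 4 with
    | 0 => [0]
    | 2 => [5]
    | _ => []
  | 6 => match x % 4 with
    | 0 => [0]
    | 1 => [6]
    | _ => []
  | _ => match x % 4 with
    | 0 => [0, 7]
    | _ => []

/-- `f n`, evaluated by the kernel after `n` has been reduced to a numeral. -/
def force {α : Type} (n : ℕ) (f : ℕ → α) : α :=
  Nat.rec (f 0) (fun k _ => f (Nat.succ k)) n

/-- `f L`, evaluated by the kernel after the entries of `L` have been reduced to numerals. -/
def forceList {α : Type} (L : List ℕ) : (List ℕ → α) → α :=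
  List.rec (fun f => f []) (fun a _ ih f => force a fun b => ih fun M => f (b :: M)) L

def insertSorted (t : ℕ) : List ℕ → List ℕ
  | [] => [t]
  | u :: L => bif Nat.ble t u then t :: u :: L else u :: insertSorted t L

/-- Sorting gives each multiset of codes one representative, so that equal states are recognised by
comparing lists and their coefficients can cancel. -/
def sortNat (L : List ℕ) : List ℕ := L.foldr insertSorted []

/-- The boundary codes after the letter `a`, with multiplicity and sorted. -/
def stepT (a : ℕ) (T : List ℕ) : List ℕ :=
  sortNat (T.flatMap fun t =>
    (subLetters a (t / 16)).map fun g => t % 16 + 16 * push (t / 16) g)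

/-- A state of the automaton: the window at the start, the present window, and the boundary codes
`l + 16 * x` of the sub-selections of the word read so far, from window `l` to window `x`. -/
structure State where
  start : ℕ
  win : ℕ
  subs : List ℕ

def eqList : List ℕ → List ℕ → Bool
  | [], [] => true
  | a :: L, b :: M => Nat.beq a b && eqList L M
  | _, _ => false

def State.eqb (s t : State) : Bool :=
  Nat.beq s.win t.win && (eqList s.subs t.subs && Nat.beq s.start t.start)

/-- The empty and the full sub-selection already account for three sub-selections. -/
def State.dead (s : State) : Bool :=
  Nat.ble 3 (s.subs.countP fun t => Nat.beq t 0 || (Nat.beq (t % 16) s.start && Nat.beq (t / 16) s.win))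

def State.step (s : State) (a : ℕ) : State := ⟨s.start, push s.win a, stepT a s.subs⟩

/-- `f s`, evaluated by the kernel after `s` has been reduced to numerals. -/
def State.force {α : Type} (s : State) (f : State → α) : α :=
  GenPetersen.force s.start fun a => GenPetersen.force s.win fun b =>
    forceList s.subs fun T => f ⟨a, b, T⟩

/-- The states after one more letter, without dead ones. -/
def State.next (s : State) : List State :=
  ((nextLetters s.win).map s.step).filter fun t => !t.dead

/-- Add `c` times the state `s` to a combination of states. -/
def addTerm (s : State) (c : ℤ) : List (State × ℤ) → List (State × ℤ)
  | [] => [(s, c)]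
  | (t, d) :: L => bif s.eqb t then (t, d + c) :: L else (t, d) :: addTerm s c L

/-- One step of the automaton on combinations of states. -/
def adv (D : List (State × ℤ)) : List (State × ℤ) :=
  D.foldr (fun p E => p.1.next.foldr (fun t E => t.force fun t => addTerm t p.2 E) E) []

/-- The word closes up, with exactly two sub-selections. -/
def State.acc (s : State) : Bool :=
  Nat.beq s.start s.win && Nat.beq 2 (s.subs.countP fun t => Nat.beq (t % 16) (t / 16))

/-- The windows contained in `W`. -/
def subWin (W : ℕ) : List ℕ :=
  (List.range 16).filter fun x => Nat.beq (Nat.land x W) x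

/-- The state before the first letter, with start window `W`. -/
def init (W : ℕ) : State := ⟨W, W, (subWin W).map fun x => x + 16 * x⟩

def isZero (D : List (State × ℤ)) : Bool := D.all fun p => decide (p.2 = 0)

def addTerms (c : ℤ) (D E : List (State × ℤ)) : List (State × ℤ) :=
  D.foldr (fun p E => addTerm p.1 (c * p.2) E) E

/-- `E` plus the combination of `D`, `adv D`, `adv (adv D)`, … with the coefficients `q`. -/
def combine : List ℤ → List (State × ℤ) → List (State × ℤ) → List (State × ℤ)
  | [], _, E => E
  | c :: q, D, E => combine q (adv D) (bif decide (c = 0) then E else addTerms c D E)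

/-- The total weight of the accepting states. -/
def value (D : List (State × ℤ)) : ℤ := D.foldr (fun p z => bif p.1.acc then p.2 + z else z) 0

def values : ℕ → List (State × ℤ) → List ℤ
  | 0, _ => []
  | n + 1, D => value D :: values n (adv D)

/-! ### Meaning of the automaton -/

/-- A letter records which of the edges `outer i`, `inner i`, `spoke i` are selected. -/
abbrev Letter := Bool × Bool × Bool

def Letter.code (a : Letter) : ℕ := a.1.toNat + 2 * a.2.1.toNat + 4 * a.2.2.toNat

/-- All vertices along the word `w` have degree two. -/
def DegRun : ℕ → List ℕ → Prop
  | _, [] => True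
  | W, a :: w => degOK W a ∧ DegRun (push W a) w

/-- Along the word `w`, the word `v` selects at each vertex all or none of the edges. -/
def SubRun : ℕ → ℕ → List ℕ → List ℕ → Prop
  | W, x, a :: w, g :: v => subOK W a x g ∧ SubRun (push W a) (push x g) w v
  | _, _, _, _ => True

/-- The number of sub-selections of `w` that lead from the window `x` to the window `l`. -/
def subCount (l : ℕ) : ℕ → ℕ → List ℕ → ℕ
  | _, x, [] => if x = l then 1 else 0
  | W, x, a :: w =>
    ((letters.filter (subOK W a x)).map fun g => subCount l (push W a) (push x g) w).sum

/-- The word `w` completes the state `s` to a cyclic word with exactly two sub-selections. -/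
def State.Completes (s : State) (w : List ℕ) : Prop :=
  DegRun s.win w ∧ w.foldl push s.win = s.start ∧
    (s.subs.map fun t => subCount (t % 16) s.win (t / 16) w).sum = 2

/-- The codes of the letters of a word. -/
def codes {n : ℕ} (f : Fin n → Letter) : List ℕ := List.ofFn fun i => (f i).code

open Classical in
/-- The number of words of length `n` that complete `s`. -/
noncomputable def State.count (s : State) (n : ℕ) : ℤ :=
  ∑ f : Fin n → Letter, if s.Completes (codes f) then 1 else 0

/-- The weighted number of words of length `n` that complete a state in the list `D`. -/
noncomputable def total (D : List (State × ℤ)) (n : ℕ) : ℤ :=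
  (D.map fun p => p.2 * p.1.count n).sum

/-! ### Soundness of the automaton -/

theorem force_eq {α : Type} (n : ℕ) (f : ℕ → α) : force n f = f n := by
  cases n <;> rfl

theorem forceList_eq {α : Type} (L : List ℕ) (f : List ℕ → α) : forceList L f = f L := by
  induction L generalizing f with
  | nil => rfl
  | cons a L ih =>
    change force a (fun b => forceList L fun M => f (b :: M)) = _
    rw [force_eq, ih]

theorem State.force_eq {α : Type} (s : State) (f : State → α) : s.force f = f s := by
  simp only [State.force, GenPetersen.force_eq, forceList_eq]

theorem insertSorted_perm (t : ℕ) (L : List ℕ) : (insertSorted t L).Perm (t :: L) := by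
  induction L with
  | nil => exact List.Perm.refl _
  | cons u L ih =>
    rw [insertSorted]
    cases Nat.ble t u
    · exact (ih.cons u).trans (List.Perm.swap t u L)
    · exact List.Perm.refl _

theorem sortNat_perm (L : List ℕ) : (sortNat L).Perm L := by
  induction L with
  | nil => exact List.Perm.refl _
  | cons t L ih => exact (insertSorted_perm t _).trans (ih.cons t)

theorem eqList_sound {L M : List ℕ} (h : eqList L M = true) : L = M := by
  induction L generalizing M with
  | nil => cases M with
    | nil => rfl
    | cons => simp [eqList] at h
  | cons a L ih => cases M with
    | nil => simp [eqList] at h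
    | cons b M =>
      simp only [eqList, Bool.and_eq_true, Nat.beq_eq] at h
      rw [h.1, ih h.2]

theorem State.eqb_sound {s t : State} (h : s.eqb t = true) : s = t := by
  simp only [State.eqb, Bool.and_eq_true, Nat.beq_eq] at h
  cases s; cases t
  simp only [State.mk.injEq]
  exact ⟨h.2.2, h.1, eqList_sound h.2.1⟩

theorem total_cons (p : State × ℤ) (D : List (State × ℤ)) (n : ℕ) :
    total (p :: D) n = p.2 * p.1.count n + total D n := by
  simp [total]

theorem total_addTerm (s : State) (c : ℤ) (D : List (State × ℤ)) (n : ℕ) :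
    total (addTerm s c D) n = c * s.count n + total D n := by
  induction D with
  | nil => simp [addTerm, total]
  | cons p D ih =>
    obtain ⟨t, d⟩ := p
    rw [addTerm]
    cases h : s.eqb t
    · simp only [cond_false, total_cons, ih]; ring
    · simp only [cond_true, total_cons, State.eqb_sound h]; ring

theorem total_addTerms (c : ℤ) (D E : List (State × ℤ)) (n : ℕ) :
    total (addTerms c D E) n = c * total D n + total E n := by
  induction D with
  | nil => simp [addTerms, total]
  | cons p D ih =>
    have : addTerms c (p :: D) E = addTerm p.1 (c * p.2) (addTerms c D E) := rfl
    rw [this, total_addTerm, ih, total_cons]; ring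

theorem sum_letters {M : Type*} [AddCommMonoid M] (p : ℕ → Bool) (φ : ℕ → M) :
    ((letters.filter p).map φ).sum = ∑ a : Letter, if p a.code then φ a.code else 0 := by
  have key : ∀ L : List ℕ,
      ((L.filter p).map φ).sum = (L.map fun a => if p a then φ a else 0).sum := by
    intro L
    induction L with
    | nil => rfl
    | cons a L ih =>
      by_cases h : p a <;> simp [h, ih]
  rw [key]
  simp [Fintype.sum_prod_type, letters, Letter.code]
  abel

/-- Only the two low bits of the window, the edges arriving at the present two vertices, matter;
this leaves four cases. -/
theorem filter_degOK (W : ℕ) : letters.filter (degOK W) = nextLetters W := by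
  have h1 : ∀ r < 4, letters.filter (degOK r) = nextLetters r := by decide +kernel
  have h2 : degOK W = degOK (W % 4) := by
    funext a
    simp only [degOK, outerCode, innerCode]
    rw [show W % 4 % 2 = W % 2 by omega, show W % 4 / 2 % 2 = W / 2 % 2 by omega]
  have h3 : nextLetters W = nextLetters (W % 4) := by simp [nextLetters]
  rw [h2, h3]
  exact h1 _ (Nat.mod_lt _ (by norm_num))

theorem filter_subOK {W a : ℕ} (ha : a ∈ nextLetters W) (x : ℕ) :
    letters.filter (subOK W a x) = subLetters a x := by
  have h1 : ∀ r < 4, ∀ y < 4, ∀ a ∈ nextLetters r,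
    letters.filter (subOK r a y) = subLetters a y := by decide +kernel
  have h2 : subOK W a x = subOK (W % 4) a (x % 4) := by
    funext g
    simp only [subOK, outerCode, innerCode]
    rw [show W % 4 % 2 = W % 2 by omega, show W % 4 / 2 % 2 = W / 2 % 2 by omega,
      show x % 4 % 2 = x % 2 by omega, show x % 4 / 2 % 2 = x / 2 % 2 by omega]
  have h3 : nextLetters W = nextLetters (W % 4) := by simp [nextLetters]
  have h4 : subLetters a x = subLetters a (x % 4) := by simp [subLetters]
  rw [h2, h4]
  rw [h3] at ha
  exact h1 _ (Nat.mod_lt _ (by norm_num)) _ (Nat.mod_lt _ (by norm_num)) _ ha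

theorem push_sub (t y : ℕ) : (t % 16 + 16 * y) % 16 = t % 16 ∧ (t % 16 + 16 * y) / 16 = y := by
  omega

/-- `subCount` branches over the first letter of a sub-selection, and `stepT` does this branching
for all boundary codes at once; sorting does not change the sum. -/
theorem sum_stepT {W a : ℕ} (ha : a ∈ nextLetters W) (T w : List ℕ) :
    ((stepT a T).map fun t => subCount (t % 16) (push W a) (t / 16) w).sum =
      (T.map fun t => subCount (t % 16) W (t / 16) (a :: w)).sum := by
  rw [stepT, ((sortNat_perm _).map _).sum_eq]
  induction T with
  | nil => rfl
  | cons t T ih =>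
    rw [List.flatMap_cons, List.map_append, List.sum_append, ih, List.map_cons, List.sum_cons]
    congr 1
    rw [subCount, filter_subOK ha, List.map_map]
    congr 1
    refine List.map_congr_left fun g _ => ?_
    simp only [Function.comp, (push_sub t _).1, (push_sub t _).2]

theorem completes_cons (s : State) (a : ℕ) (w : List ℕ) (ha : a ∈ letters) :
    s.Completes (a :: w) ↔ a ∈ nextLetters s.win ∧ (s.step a).Completes w := by
  have h : degOK s.win a = true ↔ a ∈ nextLetters s.win := by
    rw [← filter_degOK, List.mem_filter]; simp [ha]
  simp only [State.Completes, DegRun, h, List.foldl_cons, State.step]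
  constructor
  · rintro ⟨⟨h1, h2⟩, h3, h4⟩
    exact ⟨h1, h2, h3, by rw [sum_stepT h1, h4]⟩
  · rintro ⟨h1, h2, h3, h4⟩
    exact ⟨⟨h1, h2⟩, h3, by rw [← sum_stepT h1, h4]⟩

theorem subCount_zero_pos (W : ℕ) (w : List ℕ) : 1 ≤ subCount 0 W 0 w := by
  induction w generalizing W with
  | nil => simp [subCount]
  | cons a w ih =>
    rw [subCount]
    have h0 : (0 : ℕ) ∈ letters.filter (subOK W a 0) := by
      simp [letters, subOK, outerCode, innerCode]
    exact (ih (push W a)).trans (List.le_sum_of_mem (List.mem_map.2 ⟨0, h0, rfl⟩))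

theorem subCount_full_pos (W l : ℕ) (w : List ℕ) (hw : ∀ a ∈ w, a ∈ letters)
    (hl : w.foldl push W = l) : 1 ≤ subCount l W W w := by
  induction w generalizing W with
  | nil => rw [subCount, if_pos (show W = l from hl)]
  | cons a w ih =>
    rw [subCount]
    have h0 : a ∈ letters.filter (subOK W a W) := by
      rw [List.mem_filter]
      exact ⟨hw a (by simp), by simp [subOK]⟩
    exact (ih (push W a) (fun b hb => hw b (by simp [hb])) hl).trans
      (List.le_sum_of_mem (List.mem_map.2 ⟨a, h0, rfl⟩))

/-- A sub-selection with code 0 can be continued by selecting nothing, and one with the codes of the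
full selection by selecting everything. Each thus contributes at least one to the final count, which
exceeds two. -/
theorem not_completes_of_dead {s : State} (hs : s.dead = true) (w : List ℕ)
    (hw : ∀ a ∈ w, a ∈ letters) : ¬ s.Completes w := by
  rintro ⟨-, h2, h3⟩
  rw [State.dead, Nat.ble_eq] at hs
  have key : ∀ T : List ℕ,
      (T.countP fun t => Nat.beq t 0 || (Nat.beq (t % 16) s.start && Nat.beq (t / 16) s.win)) ≤
        (T.map fun t => subCount (t % 16) s.win (t / 16) w).sum := by
    intro T
    induction T with
    | nil => simp
    | cons t T ih =>
      rw [List.countP_cons, List.map_cons, List.sum_cons, add_comm]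
      refine add_le_add ?_ ih
      split
      case isFalse => exact Nat.zero_le _
      case isTrue h =>
        simp only [Bool.or_eq_true, Bool.and_eq_true, Nat.beq_eq] at h
        rcases h with rfl | ⟨h, h'⟩
        · exact subCount_zero_pos _ _
        · rw [h, h']; exact subCount_full_pos _ _ _ hw h2
  have := key s.subs
  omega

theorem code_mem (a : Letter) : a.code ∈ letters := by
  revert a; decide

theorem mem_codes {n : ℕ} (f : Fin n → Letter) : ∀ a ∈ codes f, a ∈ letters := by
  intro a ha
  obtain ⟨i, rfl⟩ := List.mem_ofFn.1 ha
  exact code_mem _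

theorem count_of_dead {s : State} (hs : s.dead = true) (n : ℕ) : s.count n = 0 := by
  rw [State.count]
  refine Finset.sum_eq_zero fun f _ => if_neg ?_
  exact not_completes_of_dead hs _ (mem_codes f)

theorem codes_cons {n : ℕ} (a : Letter) (f : Fin n → Letter) :
    codes (Fin.cons a f : Fin (n + 1) → Letter) = a.code :: codes f := by
  simp [codes, List.ofFn_succ]

theorem sum_words_succ {M : Type*} [AddCommMonoid M] (n : ℕ) (φ : (Fin (n + 1) → Letter) → M) :
    ∑ f, φ f = ∑ a : Letter, ∑ f : Fin n → Letter, φ (Fin.cons a f) := by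
  rw [← Fintype.sum_prod_type']
  exact (Fintype.sum_equiv (Fin.consEquiv fun _ => Letter) _ _ fun p => rfl).symm

/-- The words are sorted by their first letter; the dead successors dropped by `State.next` have
count zero. -/
theorem count_succ (s : State) (n : ℕ) :
    s.count (n + 1) = (s.next.map fun t => t.count n).sum := by
  classical
  have h1 : (s.next.map fun t => t.count n).sum =
      ((nextLetters s.win).map fun a => (s.step a).count n).sum := by
    rw [State.next]
    induction nextLetters s.win with
    | nil => rfl
    | cons a L ih =>
      rw [List.map_cons, List.filter_cons, List.map_cons, List.sum_cons, ← ih]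
      cases h : (s.step a).dead
      · simp
      · simp [count_of_dead h]
  rw [h1, ← filter_degOK, sum_letters, State.count, sum_words_succ]
  refine Finset.sum_congr rfl fun a _ => ?_
  have hm : degOK s.win a.code = true ↔ a.code ∈ nextLetters s.win := by
    rw [← filter_degOK, List.mem_filter]; simp [code_mem]
  split
  case isTrue h =>
    rw [State.count]
    refine Finset.sum_congr rfl fun f _ => ?_
    simp only [codes_cons, completes_cons _ _ _ (code_mem a), hm.1 h, true_and]
  case isFalse h =>
    refine Finset.sum_eq_zero fun f _ => if_neg ?_
    rw [codes_cons, completes_cons _ _ _ (code_mem a), ← hm]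
    exact fun h' => h h'.1

theorem total_adv (D : List (State × ℤ)) (n : ℕ) : total (adv D) n = total D (n + 1) := by
  induction D with
  | nil => rfl
  | cons p D ih =>
    have h1 : adv (p :: D) =
      p.1.next.foldr (fun t E => t.force fun t => addTerm t p.2 E) (adv D) := rfl
    rw [h1, total_cons, count_succ, ← ih]
    induction p.1.next with
    | nil => simp
    | cons t L ih' =>
      rw [List.foldr_cons, State.force_eq, total_addTerm, ih', List.map_cons, List.sum_cons]
      ring

/-- The combination `q₀ u 0 + q₁ u 1 + …`. -/
def combination : List ℤ → (ℕ → ℤ) → ℤ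
  | [], _ => 0
  | c :: q, u => c * u 0 + combination q fun k => u (k + 1)

/-- Applying `adv` shifts the sequence `total D`, so one formal identity between combinations of
states yields a linear relation at every `n` simultaneously. -/
theorem total_combine (q : List ℤ) (D E : List (State × ℤ)) (n : ℕ) :
    total (combine q D E) n = total E n + combination q fun k => total D (n + k) := by
  induction q generalizing D E with
  | nil => simp [combine, combination]
  | cons c q ih =>
    rw [combine, ih, combination]
    have h1 : total (bif decide (c = 0) then E else addTerms c D E) n =
        total E n + c * total D n := by
      by_cases h : c = 0
      · simp [h]
      · simp only [h, decide_false, cond_false, total_addTerms]; ring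
    simp only [h1, total_adv, add_zero, add_assoc]

theorem total_of_isZero {D : List (State × ℤ)} (h : isZero D = true) (n : ℕ) : total D n = 0 := by
  induction D with
  | nil => rfl
  | cons p D ih =>
    simp only [isZero, List.all_cons, Bool.and_eq_true, decide_eq_true_eq] at h
    rw [total_cons, h.1, ih h.2]; simp

theorem count_zero (s : State) : s.count 0 = bif s.acc then 1 else 0 := by
  have h1 : (s.subs.map fun t => subCount (t % 16) s.win (t / 16) []).sum =
      s.subs.countP fun t => Nat.beq (t % 16) (t / 16) := by
    induction s.subs with
    | nil => rfl
    | cons t T ih =>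
      rw [List.map_cons, List.sum_cons, ih, List.countP_cons, subCount, add_comm]
      simp only [Nat.beq_eq, @eq_comm _ (t / 16)]
  have h2 : s.Completes [] ↔ s.acc = true := by
    simp only [State.Completes, DegRun, true_and, h1, List.foldl_nil, State.acc, Bool.and_eq_true,
      Nat.beq_eq]
    rw [eq_comm, @eq_comm _ 2]
  simp only [State.count, codes, List.ofFn_zero, h2]
  cases s.acc <;> simp

theorem value_eq (D : List (State × ℤ)) : value D = total D 0 := by
  induction D with
  | nil => rfl
  | cons p D ih =>
    have : value (p :: D) = bif p.1.acc then p.2 + value D else value D := rfl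
    rw [this, total_cons, count_zero, ih]
    cases p.1.acc <;> simp

theorem values_eq (k : ℕ) (D : List (State × ℤ)) :
    values k D = (List.range k).map (total D) := by
  induction k generalizing D with
  | zero => rfl
  | succ k ih =>
    rw [values, ih, List.range_succ_eq_map, List.map_cons, List.map_map, value_eq]
    congr 1
    exact List.map_congr_left fun j _ => total_adv D j

/-! ### Hamiltonian cycles and minimal two-factors -/

/-- The set `C` of edges has no loops and every vertex has degree two in it. -/
def IsTwoFactor {V E : Type*} (ends : E → Sym2 V) (C : Set E) : Prop :=
  (∀ e ∈ C, ¬ (ends e).IsDiag) ∧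
    ∀ v, ∃ a b, a ≠ b ∧ ∀ e, (e ∈ C ∧ v ∈ ends e) ↔ (e = a ∨ e = b)

/-- At every vertex the set `c` contains all or none of the edges of `C`. -/
def IsClosedIn {V E : Type*} (ends : E → Sym2 V) (C c : Set E) : Prop :=
  ∀ v, ∀ a ∈ c, ∀ b ∈ C, v ∈ ends a → v ∈ ends b → b ∈ c

/-! ### From walks to minimal two-factors -/

section Walk

variable {V E : Type*} {ends : E → Sym2 V} {N : ℕ} {x : ZMod N → V} {e : ZMod N → E}

theorem mem_ends_walk (hx : Function.Injective x) (he : ∀ i, ends (e i) = s(x i, x (i + 1)))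
    (i j : ZMod N) : x j ∈ ends (e i) ↔ j = i ∨ j = i + 1 := by
  rw [he, Sym2.mem_iff, hx.eq_iff, hx.eq_iff]

theorem isTwoFactor_of_walk (hN : 3 ≤ N) (hx : Function.Bijective x)
    (he : ∀ i, ends (e i) = s(x i, x (i + 1))) : IsTwoFactor ends (Set.range e) := by
  have : Fact (1 < N) := ⟨by omega⟩
  -- This separates `x (j - 1)` from `x (j + 1)`, so that the two edges of the walk at `x j` are
  -- different.
  have h2 : (2 : ZMod N) ≠ 0 := by
    intro h
    have : ((2 : ℕ) : ZMod N) = 0 := by exact_mod_cast h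
    rw [ZMod.natCast_eq_zero_iff] at this
    exact absurd (Nat.le_of_dvd (by norm_num) this) (by omega)
  constructor
  · rintro _ ⟨i, rfl⟩ h
    rw [he, Sym2.mk_isDiag_iff, hx.1.eq_iff] at h
    simp at h
  · intro v
    obtain ⟨j, rfl⟩ := hx.2 v
    refine ⟨e j, e (j - 1), fun h => ?_, fun a => ⟨?_, ?_⟩⟩
    · have : x (j + 1) ∈ ends (e (j - 1)) := by
        rw [← h, mem_ends_walk hx.1 he]; right; rfl
      rw [mem_ends_walk hx.1 he] at this
      rcases this with h | h
      · exact h2 (by linear_combination h)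
      · simp at h
    · rintro ⟨⟨i, rfl⟩, h⟩
      rw [mem_ends_walk hx.1 he] at h
      rcases h with rfl | rfl
      · left; rfl
      · right; simp
    · rintro (rfl | rfl)
      · exact ⟨⟨_, rfl⟩, by rw [mem_ends_walk hx.1 he]; left; rfl⟩
      · exact ⟨⟨_, rfl⟩, by rw [mem_ends_walk hx.1 he]; right; simp⟩

/-- Consecutive edges share a vertex, so a closed subset containing one edge contains the next one,
and so on around the walk. -/
theorem closed_of_walk [NeZero N] (he : ∀ i, ends (e i) = s(x i, x (i + 1)))
    {c : Set E} (hc : c ⊆ Set.range e) (h : IsClosedIn ends (Set.range e) c) :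
    c = ∅ ∨ c = Set.range e := by
  rcases c.eq_empty_or_nonempty with h0 | ⟨a, ha⟩
  · left; exact h0
  right
  refine hc.antisymm ?_
  obtain ⟨i, rfl⟩ := hc ha
  have key : ∀ k : ℕ, e (i + k) ∈ c := by
    intro k
    induction k with
    | zero => simpa using ha
    | succ k ih =>
      refine h (x (i + k + 1)) _ ih _ ⟨_, rfl⟩ (by rw [he]; simp) ?_
      rw [he, Nat.cast_succ, ← add_assoc]; simp
  rintro _ ⟨j, rfl⟩
  simpa using key (j - i).val

end Walk

/-! ### From minimal two-factors to walks -/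

section Darts

variable {V E : Type*} (ends : E → Sym2 V) (C : Set E)

/-- An edge of `C` with one of its end points. -/
abbrev Dart := {d : V × E // d.2 ∈ C ∧ d.1 ∈ ends d.2}

variable {ends C}

theorem exists_rev (h : IsTwoFactor ends C) (d : Dart ends C) :
    ∃ d' : Dart ends C, d'.1.1 = d.1.1 ∧ d'.1.2 ≠ d.1.2 ∧
      ∀ e ∈ C, d.1.1 ∈ ends e → e = d.1.2 ∨ e = d'.1.2 := by
  obtain ⟨⟨v, e⟩, he, hv⟩ := d
  obtain ⟨a, b, hab, H⟩ := h.2 v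
  have ha := (H a).2 (Or.inl rfl)
  have hb := (H b).2 (Or.inr rfl)
  rcases (H e).1 ⟨he, hv⟩ with rfl | rfl
  · exact ⟨⟨⟨v, b⟩, hb⟩, rfl, hab.symm, fun e he hv => (H e).1 ⟨he, hv⟩⟩
  · exact ⟨⟨⟨v, a⟩, ha⟩, rfl, hab, fun e he hv => ((H e).1 ⟨he, hv⟩).symm⟩

theorem exists_flip (h : IsTwoFactor ends C) (d : Dart ends C) :
    ∃ d' : Dart ends C, d'.1.2 = d.1.2 ∧ d'.1.1 ≠ d.1.1 ∧ ends d.1.2 = s(d.1.1, d'.1.1) := by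
  obtain ⟨⟨v, e⟩, he, hv⟩ := d
  obtain ⟨u, hu⟩ := hv
  refine ⟨⟨⟨u, e⟩, he, by simp only [hu]; simp⟩, rfl, ?_, hu⟩
  intro huv
  refine h.1 e he ?_
  rw [show ends e = s(v, u) from hu, Sym2.mk_isDiag_iff]
  exact huv.symm

variable {rev flip : Dart ends C → Dart ends C}

theorem rev_rev (rev1 : ∀ d, (rev d).1.1 = d.1.1) (rev2 : ∀ d, (rev d).1.2 ≠ d.1.2)
    (rev3 : ∀ d, ∀ e ∈ C, d.1.1 ∈ ends e → e = d.1.2 ∨ e = (rev d).1.2) :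
    Function.Involutive rev := by
  intro d
  have hv : (rev (rev d)).1.1 = d.1.1 := (rev1 _).trans (rev1 _)
  refine Subtype.ext (Prod.ext hv ?_)
  rcases rev3 d (rev (rev d)).1.2 (rev (rev d)).2.1 (hv ▸ (rev (rev d)).2.2) with h | h
  · exact h
  · exact absurd h (rev2 _)

theorem flip_flip (flip1 : ∀ d, (flip d).1.2 = d.1.2)
    (flip3 : ∀ d, ends d.1.2 = s(d.1.1, (flip d).1.1)) : Function.Involutive flip := by
  intro d
  refine Subtype.ext (Prod.ext ?_ ((flip1 _).trans (flip1 _)))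
  have h := flip3 (flip d)
  rw [flip1, flip3 d, Sym2.eq_swap, Sym2.congr_right] at h
  exact h.symm

/-- With `f = rev ∘ flip`, the dihedral relation `f^k ∘ rev ∘ f^k = rev` holds. If `f^m d = rev d`,
cancelling half of the iterates leaves a dart fixed by `rev` (even `m`) or by `flip` (odd `m`), and
neither exists. -/
theorem iterate_ne_rev (hrev : Function.Involutive rev) (hflip : Function.Involutive flip)
    (rev2 : ∀ d, (rev d).1.2 ≠ d.1.2) (flip2 : ∀ d, (flip d).1.1 ≠ d.1.1) (m : ℕ)
    (d : Dart ends C) : (rev ∘ flip)^[m] d ≠ rev d := by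
  have hinj : Function.Injective (rev ∘ flip) := hrev.injective.comp hflip.injective
  have hback : ∀ k d, (rev ∘ flip)^[k] (rev ((rev ∘ flip)^[k] d)) = rev d := by
    intro k
    induction k with
    | zero => intro d; rfl
    | succ k ih =>
      intro d
      rw [Function.iterate_succ_apply, Function.iterate_succ_apply']
      simp only [Function.comp_apply, hrev _, hflip _]
      exact ih d
  intro h
  rcases Nat.even_or_odd' m with ⟨k, rfl | rfl⟩
  · rw [two_mul, Function.iterate_add_apply, ← hback k d] at h
    have := hinj.iterate k h
    exact rev2 _ (congrArg (fun d : Dart ends C => d.1.2) this).symm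
  · rw [show 2 * k + 1 = k + (k + 1) by ring, Function.iterate_add_apply, ← hback k d,
      Function.iterate_succ_apply'] at h
    have := hrev.injective (hinj.iterate k h)
    exact flip2 _ (congrArg (fun d : Dart ends C => d.1.1) this)

/-- The walk is the orbit of a dart under `rev ∘ flip`: cross the edge, then leave by the other
edge. By `iterate_ne_rev` the orbit never meets a vertex in the opposite direction, so it repeats a
vertex only after a full period. Its edges form a non-empty closed subset, which is `C` by
minimality; hence it reaches all vertices and its period is their number. -/
theorem exists_walk_of_minimal [Finite V] [Finite E] [Nonempty V] (h : IsTwoFactor ends C)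
    (hmin : ∀ c ⊆ C, IsClosedIn ends C c → c = ∅ ∨ c = C) {N : ℕ} (hN : Nat.card V = N) :
    ∃ (x : ZMod N → V) (e : ZMod N → E),
      Function.Bijective x ∧ (∀ i, ends (e i) = s(x i, x (i + 1))) ∧ Set.range e = C := by
  choose rev rev1 rev2 rev3 using exists_rev h
  choose flip flip1 flip2 flip3 using exists_flip h
  have hrev := rev_rev rev1 rev2 rev3
  have hflip := flip_flip flip1 flip3
  have hne := iterate_ne_rev hrev hflip rev2 flip2
  set f := rev ∘ flip with hf
  have hinj : Function.Injective f := hrev.injective.comp hflip.injective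
  obtain ⟨d₀⟩ : Nonempty (Dart ends C) := by
    obtain ⟨v⟩ := ‹Nonempty V›
    obtain ⟨a, b, -, H⟩ := h.2 v
    exact ⟨⟨⟨v, a⟩, (H a).2 (Or.inl rfl)⟩⟩
  have hper : d₀ ∈ Function.periodicPts f := hinj.mem_periodicPts d₀
  have hpos := Function.minimalPeriod_pos_of_mem_periodicPts hper
  set p := Function.minimalPeriod f d₀ with hp
  let d : ℕ → Dart ends C := fun k => f^[k] d₀
  have hsucc : ∀ k, d (k + 1) = f (d k) := fun k => Function.iterate_succ_apply' f k d₀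
  have hmod : ∀ k, d (k % p) = d k := fun k => Function.iterate_mod_minimalPeriod_eq
  have hends : ∀ k, ends (d k).1.2 = s((d k).1.1, (d (k + 1)).1.1) := by
    intro k
    rw [flip3, hsucc, hf, Function.comp_apply, rev1]
  have hrevd : ∀ k, (rev (d (k + 1))).1.2 = (d k).1.2 := by
    intro k
    rw [hsucc, hf, Function.comp_apply, hrev, flip1]
  have hle : ∀ j k, j ≤ k → (d j).1.1 = (d k).1.1 → d j = d k := by
    intro j k hjk hv
    obtain ⟨m, rfl⟩ := Nat.exists_eq_add_of_le hjk
    have hm : d (j + m) = f^[m] (d j) := by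
      change f^[j + m] d₀ = f^[m] (f^[j] d₀)
      rw [add_comm, Function.iterate_add_apply]
    rcases rev3 (d j) (d (j + m)).1.2 (d (j + m)).2.1 (hv ▸ (d (j + m)).2.2) with h1 | h1
    · exact Subtype.ext (Prod.ext hv h1.symm)
    · exact absurd (hm.symm.trans (Subtype.ext (Prod.ext (hv.symm.trans (rev1 _).symm) h1)))
        (hne m (d j))
  have heq : ∀ j k, (d j).1.1 = (d k).1.1 → d j = d k := by
    intro j k hv
    rcases le_total j k with h1 | h1
    · exact hle j k h1 hv
    · exact (hle k j h1 hv.symm).symm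
  have hedge : ∀ k, ∀ e ∈ C, (d k).1.1 ∈ ends e → ∃ j, e = (d j).1.2 := by
    intro k e he hk
    -- The index `k + p - 1` serves as the predecessor of `k` in the cyclic order, also for `k = 0`.
    have hk' : d (k + p - 1 + 1) = d k := by
      rw [show k + p - 1 + 1 = k + p by omega, ← hmod, Nat.add_mod_right, hmod]
    rcases rev3 (d k) e he hk with h1 | h1
    · exact ⟨k, h1⟩
    · exact ⟨k + p - 1, by rw [h1, ← hrevd, hk']⟩
  have hall : {e | ∃ j, e = (d j).1.2} = C := by
    have hsub : {e | ∃ j, e = (d j).1.2} ⊆ C := by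
      rintro _ ⟨j, rfl⟩; exact (d j).2.1
    refine (hmin _ hsub ?_).resolve_left ?_
    · rintro v _ ⟨j, rfl⟩ b hb hva hvb
      rw [hends, Sym2.mem_iff] at hva
      rcases hva with rfl | rfl
      · exact hedge _ _ hb hvb
      · exact hedge _ _ hb hvb
    · exact Set.Nonempty.ne_empty ⟨(d 0).1.2, 0, rfl⟩
  have hsurj : ∀ v, ∃ k, (d k).1.1 = v := by
    intro v
    obtain ⟨a, b, -, H⟩ := h.2 v
    obtain ⟨ha, hv⟩ := (H a).2 (Or.inl rfl)
    rw [← hall] at ha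
    obtain ⟨j, rfl⟩ := ha
    rw [hends, Sym2.mem_iff] at hv
    rcases hv with rfl | rfl
    · exact ⟨j, rfl⟩
    · exact ⟨j + 1, rfl⟩
  have hinjOn : ∀ j k, j < p → k < p → (d j).1.1 = (d k).1.1 → j = k := fun j k hj hk hv =>
    Function.iterate_injOn_Iio_minimalPeriod hj hk (heq j k hv)
  have hpN : p = N := by
    rw [← hN]
    have hb : Function.Bijective fun k : Fin p => (d k).1.1 := by
      constructor
      · intro j k hjk
        exact Fin.ext (hinjOn j k j.2 k.2 hjk)
      · intro v
        obtain ⟨k, rfl⟩ := hsurj v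
        exact ⟨⟨k % p, Nat.mod_lt _ hpos⟩, by simp only [hmod]⟩
    rw [← Nat.card_congr (Equiv.ofBijective _ hb), Nat.card_fin]
  have : NeZero N := ⟨by omega⟩
  have hmodN : ∀ k, d (k % N) = d k := by rw [← hpN]; exact hmod
  have hval : ∀ i : ZMod N, d (i + 1).val = d (i.val + 1) := by
    intro i
    rw [ZMod.val_add, hmodN]
    rcases Nat.lt_or_ge 1 N with h1 | h1
    · have : Fact (1 < N) := ⟨h1⟩
      rw [ZMod.val_one]
    · have h2 : N = 1 := by omega
      have h3 : ∀ k, d k = d 0 := fun k => by rw [← hmodN k, h2, Nat.mod_one]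
      rw [h3, h3 (i.val + 1)]
  refine ⟨fun i => (d i.val).1.1, fun i => (d i.val).1.2, ⟨?_, ?_⟩, ?_, ?_⟩
  · intro i j hij
    exact ZMod.val_injective N (hinjOn _ _ (hpN ▸ i.val_lt) (hpN ▸ j.val_lt) hij)
  · intro v
    obtain ⟨k, rfl⟩ := hsurj v
    exact ⟨(k : ZMod N), by simp only [ZMod.val_natCast, hmodN]⟩
  · intro i
    simp only [hval]
    exact hends _
  · refine Eq.trans ?_ hall
    ext e
    constructor
    · rintro ⟨i, rfl⟩
      exact ⟨_, rfl⟩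
    · rintro ⟨j, rfl⟩
      exact ⟨(j : ZMod N), by simp only [ZMod.val_natCast, hmodN]⟩

end Darts

/-! ### Edge sets as cyclic words -/

def windowCode (p q r s : Bool) : ℕ := p.toNat + 2 * q.toNat + 4 * r.toNat + 8 * s.toNat

def tripleCode (a b c : Bool) : ℕ := a.toNat + 2 * b.toNat + 4 * c.toNat

theorem push_windowCode (p q r s : Bool) (a : Letter) :
    push (windowCode p q r s) a.code = windowCode a.1 r s a.2.1 := by
  revert p q r s a; decide

theorem outerCode_windowCode (p q r s : Bool) (a : Letter) :
    outerCode (windowCode p q r s) a.code = tripleCode p a.1 a.2.2 := by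
  revert p q r s a; decide

theorem innerCode_windowCode (p q r s : Bool) (a : Letter) :
    innerCode (windowCode p q r s) a.code = tripleCode q a.2.1 a.2.2 := by
  revert p q r s a; decide

/-- Exactly two of three propositions hold. -/
def ExactlyTwo (P Q R : Prop) : Prop := (P ∧ Q ∧ ¬ R) ∨ (P ∧ ¬ Q ∧ R) ∨ (¬ P ∧ Q ∧ R)

theorem isTwo_tripleCode (a b c : Bool) :
    isTwo (tripleCode a b c) = true ↔ ExactlyTwo (a = true) (b = true) (c = true) := by
  unfold ExactlyTwo
  revert a b c; decide

/-- Either none of three propositions hold, or they agree with three others. -/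
def NoneOrAll (P Q R P' Q' R' : Prop) : Prop :=
  (¬ P ∧ ¬ Q ∧ ¬ R) ∨ ((P ↔ P') ∧ (Q ↔ Q') ∧ (R ↔ R'))

theorem tripleCode_noneOrAll (a b c a' b' c' : Bool) :
    (Nat.beq (tripleCode a b c) 0 || Nat.beq (tripleCode a b c) (tripleCode a' b' c')) = true ↔
      NoneOrAll (a = true) (b = true) (c = true) (a' = true) (b' = true) (c' = true) := by
  unfold NoneOrAll
  revert a b c a' b' c'; decide

section Incidence

variable {V E : Type*} {ends : E → Sym2 V} {C c : Set E} {v : V} {a₁ a₂ a₃ : E}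

theorem exists_pair_iff (hv : ∀ e, v ∈ ends e ↔ e = a₁ ∨ e = a₂ ∨ e = a₃)
    (h₁₂ : a₁ ≠ a₂) (h₁₃ : a₁ ≠ a₃) (h₂₃ : a₂ ≠ a₃) :
    (∃ a b, a ≠ b ∧ ∀ e, (e ∈ C ∧ v ∈ ends e) ↔ (e = a ∨ e = b)) ↔
      ExactlyTwo (a₁ ∈ C) (a₂ ∈ C) (a₃ ∈ C) := by
  constructor
  · rintro ⟨a, b, hab, H⟩
    have H' := H
    simp only [hv] at H
    have h1 := H a₁
    have h2 := H a₂
    have h3 := H a₃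
    have ha := H a
    have hb := H b
    unfold ExactlyTwo
    grind
  · unfold ExactlyTwo
    rintro (⟨h1, h2, h3⟩ | ⟨h1, h2, h3⟩ | ⟨h1, h2, h3⟩)
    · exact ⟨a₁, a₂, h₁₂, fun e => by rw [hv]; grind⟩
    · exact ⟨a₁, a₃, h₁₃, fun e => by rw [hv]; grind⟩
    · exact ⟨a₂, a₃, h₂₃, fun e => by rw [hv]; grind⟩

/-- Agreement with `C` in `NoneOrAll` goes both ways: closedness gives one direction, and the second
conjunct, the local form of `c ⊆ C`, gives the other. -/
theorem closed_at_iff (hv : ∀ e, v ∈ ends e ↔ e = a₁ ∨ e = a₂ ∨ e = a₃) :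
    ((∀ a ∈ c, ∀ b ∈ C, v ∈ ends a → v ∈ ends b → b ∈ c) ∧ ∀ a ∈ c, v ∈ ends a → a ∈ C) ↔
      NoneOrAll (a₁ ∈ c) (a₂ ∈ c) (a₃ ∈ c) (a₁ ∈ C) (a₂ ∈ C) (a₃ ∈ C) := by
  simp only [hv]
  unfold NoneOrAll
  constructor
  · rintro ⟨h, h'⟩
    by_cases hne : ∃ a ∈ c, a = a₁ ∨ a = a₂ ∨ a = a₃
    · obtain ⟨a, ha, ha'⟩ := hne
      right
      exact ⟨⟨fun k => h' _ k (by simp), fun k => h a ha _ k ha' (by simp)⟩,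
        ⟨fun k => h' _ k (by simp), fun k => h a ha _ k ha' (by simp)⟩,
        ⟨fun k => h' _ k (by simp), fun k => h a ha _ k ha' (by simp)⟩⟩
    · left
      push Not at hne
      exact ⟨fun k => (hne _ k).1 rfl, fun k => (hne _ k).2.1 rfl, fun k => (hne _ k).2.2 rfl⟩
  · grind

end Incidence

variable {n : ℕ}

/-- The edge set described by a cyclic word. -/
def edgeSet (f : ZMod n → Letter) : Set (Edge n) :=
  {e | match e with
    | .outer i => (f i).1 = true
    | .inner i => (f i).2.1 = true
    | .spoke i => (f i).2.2 = true}

theorem outer_mem_edgeSet {f : ZMod n → Letter} {i : ZMod n} :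
    Edge.outer i ∈ edgeSet f ↔ (f i).1 = true := Iff.rfl

theorem inner_mem_edgeSet {f : ZMod n → Letter} {i : ZMod n} :
    Edge.inner i ∈ edgeSet f ↔ (f i).2.1 = true := Iff.rfl

theorem spoke_mem_edgeSet {f : ZMod n → Letter} {i : ZMod n} :
    Edge.spoke i ∈ edgeSet f ↔ (f i).2.2 = true := Iff.rfl

theorem edgeSet_injective : Function.Injective (edgeSet (n := n)) := by
  intro f g h
  funext i
  refine Prod.ext ?_ (Prod.ext ?_ ?_)
  · rw [Bool.eq_iff_iff, ← outer_mem_edgeSet, ← outer_mem_edgeSet, h]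
  · rw [Bool.eq_iff_iff, ← inner_mem_edgeSet, ← inner_mem_edgeSet, h]
  · rw [Bool.eq_iff_iff, ← spoke_mem_edgeSet, ← spoke_mem_edgeSet, h]

theorem edgeSet_surjective : Function.Surjective (edgeSet (n := n)) := by
  classical
  intro C
  refine ⟨fun i => (decide (.outer i ∈ C), decide (.inner i ∈ C), decide (.spoke i ∈ C)), ?_⟩
  ext e
  cases e <;> simp [edgeSet]

/-- The selected edges among `outer (i - 1)`, `inner (i - 3)`, `inner (i - 2)`,
`inner (i - 1)`. -/
def windowAt (f : ZMod n → Letter) (i : ZMod n) : ℕ :=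
  windowCode (f (i - 1)).1 (f (i - 3)).2.1 (f (i - 2)).2.1 (f (i - 1)).2.1

def CyclicDeg (f : ZMod n → Letter) : Prop := ∀ i, degOK (windowAt f i) (f i).code = true

def CyclicSub (f g : ZMod n → Letter) : Prop :=
  ∀ i, subOK (windowAt f i) (f i).code (windowAt g i) (g i).code = true

def noLetters : ZMod n → Letter := fun _ => (false, false, false)

theorem edgeSet_noLetters : edgeSet (noLetters (n := n)) = ∅ := by
  ext e
  cases e <;> simp [edgeSet, noLetters]

theorem v_mem_ends (i : ZMod n) (e : Edge n) :
    Vertex.v i ∈ ends 3 e ↔ e = .outer (i - 1) ∨ e = .outer i ∨ e = .spoke i := by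
  cases e <;> simp [ends, eq_sub_iff_add_eq, eq_comm, or_comm]

theorem w_mem_ends (i : ZMod n) (e : Edge n) :
    Vertex.w i ∈ ends 3 e ↔ e = .inner (i - 3) ∨ e = .inner i ∨ e = .spoke i := by
  cases e <;> simp [ends, eq_sub_iff_add_eq, eq_comm, or_comm]

theorem one_ne_zero_of_two_le (hn : 2 ≤ n) : (1 : ZMod n) ≠ 0 := by
  have : Fact (1 < n) := ⟨hn⟩
  exact one_ne_zero

/-- The hypotheses exclude loops and keep the three edges listed at each vertex distinct: `1 ≠ 0`
for the outer cycle, `3 ≠ 0` for the inner edges. Parallel edges do no harm, since they carry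
different labels. -/
theorem isTwoFactor_edgeSet (hn : 2 ≤ n) (h3 : (3 : ZMod n) ≠ 0) (f : ZMod n → Letter) :
    IsTwoFactor (ends 3) (edgeSet f) ↔ CyclicDeg f := by
  have h1 := one_ne_zero_of_two_le hn
  have hdiag : ∀ e ∈ edgeSet f, ¬ (ends 3 e).IsDiag := by
    intro e _
    cases e <;> simp [ends, h1, h3]
  have hV : ∀ i : ZMod n, _ := fun i => exists_pair_iff (C := edgeSet f) (v_mem_ends i)
    (by simp [h1]) (by simp) (by simp)
  have hW : ∀ i : ZMod n, _ := fun i => exists_pair_iff (C := edgeSet f) (w_mem_ends i)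
    (by simp [h3]) (by simp) (by simp)
  simp only [outer_mem_edgeSet, inner_mem_edgeSet, spoke_mem_edgeSet] at hV hW
  have hdeg : ∀ i, degOK (windowAt f i) (f i).code = true ↔
      ExactlyTwo ((f (i - 1)).1 = true) ((f i).1 = true) ((f i).2.2 = true) ∧
      ExactlyTwo ((f (i - 3)).2.1 = true) ((f i).2.1 = true) ((f i).2.2 = true) := by
    intro i
    rw [degOK, windowAt, outerCode_windowCode, innerCode_windowCode, Bool.and_eq_true,
      isTwo_tripleCode, isTwo_tripleCode]
  constructor
  · rintro ⟨-, h⟩ i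
    exact (hdeg i).2 ⟨(hV i).1 (h _), (hW i).1 (h _)⟩
  · intro h
    refine ⟨hdiag, fun v => ?_⟩
    cases v with
    | v i => exact (hV i).2 ((hdeg i).1 (h i)).1
    | w i => exact (hW i).2 ((hdeg i).1 (h i)).2

theorem isClosedIn_edgeSet (f g : ZMod n → Letter) :
    (edgeSet g ⊆ edgeSet f ∧ IsClosedIn (ends 3) (edgeSet f) (edgeSet g)) ↔ CyclicSub f g := by
  have hV : ∀ i : ZMod n, _ := fun i =>
    closed_at_iff (C := edgeSet f) (c := edgeSet g) (v_mem_ends i)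
  have hW : ∀ i : ZMod n, _ := fun i =>
    closed_at_iff (C := edgeSet f) (c := edgeSet g) (w_mem_ends i)
  simp only [outer_mem_edgeSet, inner_mem_edgeSet, spoke_mem_edgeSet] at hV hW
  have hsub : ∀ i, subOK (windowAt f i) (f i).code (windowAt g i) (g i).code = true ↔
      NoneOrAll ((g (i - 1)).1 = true) ((g i).1 = true) ((g i).2.2 = true)
        ((f (i - 1)).1 = true) ((f i).1 = true) ((f i).2.2 = true) ∧
      NoneOrAll ((g (i - 3)).2.1 = true) ((g i).2.1 = true) ((g i).2.2 = true)
        ((f (i - 3)).2.1 = true) ((f i).2.1 = true) ((f i).2.2 = true) := by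
    intro i
    rw [subOK, windowAt, windowAt, outerCode_windowCode, innerCode_windowCode,
      outerCode_windowCode, innerCode_windowCode, Bool.and_eq_true,
      tripleCode_noneOrAll, tripleCode_noneOrAll]
  constructor
  · rintro ⟨h, h'⟩ i
    exact (hsub i).2 ⟨(hV i).1 ⟨h' _, fun a ha _ => h ha⟩, (hW i).1 ⟨h' _, fun a ha _ => h ha⟩⟩
  · intro h
    have hv := fun i => (hV i).2 ((hsub i).1 (h i)).1
    have hw := fun i => (hW i).2 ((hsub i).1 (h i)).2
    constructor
    · intro e he
      cases e with
      | outer i => exact (hv i).2 _ he (by simp [v_mem_ends])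
      | inner i => exact (hw i).2 _ he (by simp [w_mem_ends])
      | spoke i => exact (hv i).2 _ he (by simp [v_mem_ends])
    · intro v
      cases v with
      | v i => exact (hv i).1
      | w i => exact (hw i).1

def vertexEquiv : Vertex n ≃ ZMod n ⊕ ZMod n where
  toFun | .v i => .inl i | .w i => .inr i
  invFun | .inl i => .v i | .inr i => .w i
  left_inv a := by cases a <;> rfl
  right_inv a := by cases a <;> rfl

def edgeEquiv : Edge n ≃ ZMod n ⊕ ZMod n ⊕ ZMod n where
  toFun | .outer i => .inl i | .inner i => .inr (.inl i) | .spoke i => .inr (.inr i)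
  invFun | .inl i => .outer i | .inr (.inl i) => .inner i | .inr (.inr i) => .spoke i
  left_inv a := by cases a <;> rfl
  right_inv a := by rcases a with a | a | a <;> rfl

instance [NeZero n] : Finite (Vertex n) := Finite.of_equiv _ vertexEquiv.symm

instance [NeZero n] : Finite (Edge n) := Finite.of_equiv _ edgeEquiv.symm

theorem card_vertex [NeZero n] : Nat.card (Vertex n) = 2 * n := by
  rw [Nat.card_congr vertexEquiv, Nat.card_sum, Nat.card_zmod, two_mul]

theorem isHamiltonianCycle_edgeSet (hn : 2 ≤ n) (h3 : (3 : ZMod n) ≠ 0) (f : ZMod n → Letter) :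
    IsHamiltonianCycle n 3 (edgeSet f) ↔
      CyclicDeg f ∧ ∀ g, CyclicSub f g → g = noLetters ∨ g = f := by
  have : NeZero n := ⟨by omega⟩
  have : NeZero (2 * n) := ⟨by omega⟩
  have : Nonempty (Vertex n) := ⟨.v 0⟩
  rw [← isTwoFactor_edgeSet hn h3]
  constructor
  · rintro ⟨x, e, hx, he, hC⟩
    rw [← hC]
    refine ⟨isTwoFactor_of_walk (by omega) hx he, fun g hg => ?_⟩
    obtain ⟨h1, h2⟩ := (isClosedIn_edgeSet f g).2 hg
    rw [← hC] at h1 h2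
    rcases closed_of_walk he h1 h2 with h | h
    · left; exact edgeSet_injective (h.trans edgeSet_noLetters.symm)
    · right; exact edgeSet_injective (h.trans hC)
  · rintro ⟨h1, h2⟩
    refine exists_walk_of_minimal h1 (fun c hc hc' => ?_) card_vertex
    obtain ⟨g, rfl⟩ := edgeSet_surjective c
    rcases h2 g ((isClosedIn_edgeSet f g).1 ⟨hc, hc'⟩) with rfl | rfl
    · left; exact edgeSet_noLetters
    · right; rfl

/-! ### From cyclic words to runs of the automaton -/

section Runs

variable {V X u v : ℕ → ℕ}

theorem degRun_range' (hV : ∀ j, V (j + 1) = push (V j) (u j)) (n k : ℕ) :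
    DegRun (V k) ((List.range' k n).map u) ↔ ∀ j < n, degOK (V (k + j)) (u (k + j)) = true := by
  induction n generalizing k with
  | zero => simp [DegRun]
  | succ n ih =>
    rw [List.range'_succ, List.map_cons, DegRun, ← hV, ih, Nat.forall_lt_succ_left]
    simp only [add_zero, add_assoc, Nat.add_comm 1]

theorem subRun_range' (hV : ∀ j, V (j + 1) = push (V j) (u j))
    (hX : ∀ j, X (j + 1) = push (X j) (v j)) (n k : ℕ) :
    SubRun (V k) (X k) ((List.range' k n).map u) ((List.range' k n).map v) ↔
      ∀ j < n, subOK (V (k + j)) (u (k + j)) (X (k + j)) (v (k + j)) = true := by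
  induction n generalizing k with
  | zero => simp [SubRun]
  | succ n ih =>
    rw [List.range'_succ, List.map_cons, List.map_cons, SubRun, ← hV, ← hX, ih,
      Nat.forall_lt_succ_left]
    simp only [add_zero, add_assoc, Nat.add_comm 1]

end Runs

open Classical in
theorem subCount_eq_sum (l W x : ℕ) (w : List ℕ) : subCount l W x w =
    ∑ g : Fin w.length → Letter,
      if SubRun W x w (codes g) ∧ (codes g).foldl push x = l then 1 else 0 := by
  induction w generalizing W x with
  | nil => simp [subCount, SubRun, codes]
  | cons a w ih =>
    rw [subCount, sum_letters]
    refine Eq.trans ?_ (sum_words_succ w.length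
      fun g => if SubRun W x (a :: w) (codes g) ∧ (codes g).foldl push x = l then 1 else 0).symm
    refine Finset.sum_congr rfl fun b _ => ?_
    simp only [codes_cons, SubRun, List.foldl_cons]
    split
    case isTrue h => simp only [ih, h, true_and]
    case isFalse h => simp [h]

variable {m : ℕ}

theorem windowAt_succ {n : ℕ} (f : ZMod n → Letter) (i : ZMod n) :
    windowAt f (i + 1) = push (windowAt f i) (f i).code := by
  rw [windowAt, windowAt, push_windowCode]
  rw [show i + 1 - 1 = i by ring, show i + 1 - 3 = i - 2 by ring, show i + 1 - 2 = i - 1 by ring]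

theorem windowAt_natCast_succ {n : ℕ} (f : ZMod n → Letter) (j : ℕ) :
    windowAt f ((j + 1 : ℕ) : ZMod n) = push (windowAt f (j : ZMod n)) (f (j : ZMod n)).code := by
  rw [Nat.cast_succ, windowAt_succ]

/-- A cyclic word, cut open. -/
def cyclicCodes (f : ZMod (m + 3) → Letter) : List ℕ :=
  codes (n := m + 3) f

theorem cyclicCodes_eq (f : ZMod (m + 3) → Letter) : cyclicCodes f =
    (List.range' 0 (m + 3)).map fun j : ℕ => (f (j : ZMod (m + 3))).code := by
  refine List.ext_getElem (by simp [cyclicCodes, codes]) fun j h1 h2 => ?_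
  simp only [cyclicCodes, codes, List.getElem_ofFn, List.getElem_map, List.getElem_range',
    one_mul, zero_add]
  congr 2
  have hj : j < m + 3 := by simpa using h2
  -- By definition `ZMod (m + 3)` is `Fin (m + 3)`.
  exact (ZMod.natCast_zmod_val (n := m + 3) (⟨j, hj⟩ : Fin (m + 3))).symm

theorem forall_zmod_iff {P : ZMod (m + 3) → Prop} :
    (∀ j < m + 3, P ((0 + j : ℕ) : ZMod (m + 3))) ↔ ∀ i, P i := by
  constructor
  · intro h i
    have := h i.val i.val_lt
    rwa [zero_add, ZMod.natCast_zmod_val] at this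
  · intro h j _
    exact h _

theorem degRun_cyclicCodes (f : ZMod (m + 3) → Letter) :
    DegRun (windowAt f 0) (cyclicCodes f) ↔ CyclicDeg f := by
  have h := degRun_range' (V := fun j : ℕ => windowAt f (j : ZMod (m + 3)))
    (windowAt_natCast_succ f) (m + 3) 0
  beta_reduce at h
  rw [Nat.cast_zero] at h
  rw [cyclicCodes_eq, h, CyclicDeg]
  exact forall_zmod_iff (P := fun i => degOK (windowAt f i) (f i).code = true)

theorem subRun_cyclicCodes (f g : ZMod (m + 3) → Letter) :
    SubRun (windowAt f 0) (windowAt g 0) (cyclicCodes f) (cyclicCodes g) ↔ CyclicSub f g := by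
  have h := subRun_range' (V := fun j : ℕ => windowAt f (j : ZMod (m + 3)))
    (X := fun j : ℕ => windowAt g (j : ZMod (m + 3)))
    (windowAt_natCast_succ f) (windowAt_natCast_succ g) (m + 3) 0
  beta_reduce at h
  rw [Nat.cast_zero] at h
  rw [cyclicCodes_eq, cyclicCodes_eq, h, CyclicSub]
  exact forall_zmod_iff
    (P := fun i => subOK (windowAt f i) (f i).code (windowAt g i) (g i).code = true)

theorem push_lt {W a : ℕ} (hW : W < 16) : push W a < 16 := by
  unfold push; omega

theorem foldl_push_lt {W : ℕ} (hW : W < 16) (w : List ℕ) : w.foldl push W < 16 := by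
  induction w generalizing W with
  | nil => exact hW
  | cons a w ih => exact ih (push_lt hW)

/-- A window remembers only three letters, so three pushes erase `W`. This is why cyclic words are
taken of length at least three. -/
theorem push_push_push {W : ℕ} (hW : W < 16) (a b c : Letter) :
    push (push (push W a.code) b.code) c.code = windowCode c.1 a.2.1 b.2.1 c.2.1 := by
  have : ∀ W < 16, ∀ a b c : Letter,
      push (push (push W a.code) b.code) c.code = windowCode c.1 a.2.1 b.2.1 c.2.1 := by
    decide +kernel
  exact this W hW a b c

theorem natCast_eq_neg (k l : ℕ) (h : k + l = m + 3) :
    ((k : ℕ) : ZMod (m + 3)) = -(l : ZMod (m + 3)) := by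
  rw [eq_neg_iff_add_eq_zero, ← Nat.cast_add, h, ZMod.natCast_self]

/-- The last three letters sit at `-3`, `-2`, `-1` and determine the final window. Closing up
therefore forces the start window to be `windowAt f 0`. -/
theorem foldl_cyclicCodes {W : ℕ} (hW : W < 16) (f : ZMod (m + 3) → Letter) :
    (cyclicCodes f).foldl push W = windowAt f 0 := by
  rw [cyclicCodes_eq, ← List.range_eq_range', List.range_succ, List.range_succ, List.range_succ]
  simp only [List.map_append, List.foldl_append, List.map_cons, List.map_nil, List.foldl_cons,
    List.foldl_nil]
  rw [push_push_push (foldl_push_lt hW _), windowAt,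
    natCast_eq_neg m 3 rfl, natCast_eq_neg (m + 1) 2 rfl, natCast_eq_neg (m + 2) 1 rfl]
  simp

theorem windowCode_lt (p q r s : Bool) : windowCode p q r s < 16 := by
  revert p q r s; decide

theorem mem_subWin {W x : ℕ} : x ∈ subWin W ↔ x < 16 ∧ Nat.land x W = x := by
  rw [subWin, List.mem_filter, List.mem_range, Nat.beq_eq]

theorem windowCode_land (p q r s p' q' r' s' : Bool) (hp : p = true → p' = true)
    (hq : q = true → q' = true) (hr : r = true → r' = true) (hs : s = true → s' = true) :
    Nat.land (windowCode p q r s) (windowCode p' q' r' s') = windowCode p q r s := by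
  revert p q r s p' q' r' s'; decide +kernel

theorem windowAt_mem_subWin {n : ℕ} {f g : ZMod n → Letter} (h : CyclicSub f g) (i : ZMod n) :
    windowAt g i ∈ subWin (windowAt f i) := by
  have hsub := ((isClosedIn_edgeSet f g).2 h).1
  exact mem_subWin.2 ⟨windowCode_lt _ _ _ _, windowCode_land _ _ _ _ _ _ _ _
    (fun k => hsub (a := .outer _) k) (fun k => hsub (a := .inner _) k)
    (fun k => hsub (a := .inner _) k) (fun k => hsub (a := .inner _) k)⟩

theorem subWin_nodup (W : ℕ) : (subWin W).Nodup := List.nodup_range.filter _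

-- A cyclic sub-selection has a start window contained in that of `f` and returns to it after one
-- turn, so summing over these windows counts each sub-selection once.
open Classical in
theorem sum_init (f : ZMod (m + 3) → Letter) :
    ((init (windowAt f 0)).subs.map fun t =>
      subCount (t % 16) (windowAt f 0) (t / 16) (cyclicCodes f)).sum =
        (Finset.univ.filter fun g : ZMod (m + 3) → Letter => CyclicSub f g).card := by
  have hlen : (cyclicCodes f).length = m + 3 := by simp [cyclicCodes, codes]
  have hcount : ∀ x < 16, subCount x (windowAt f 0) x (cyclicCodes f) =
      ∑ g : ZMod (m + 3) → Letter, if x = windowAt g 0 ∧ CyclicSub f g then 1 else 0 := by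
    intro x hx
    rw [subCount_eq_sum]
    generalize hw : cyclicCodes f = w
    have hlen' : w.length = m + 3 := hw ▸ hlen
    -- With the length generalised to `k`, substituting `k = m + 3` turns `Fin k` into `ZMod (m +
    -- 3)` definitionally.
    have key : ∀ (k : ℕ) (hk : k = m + 3),
        (∑ g : Fin k → Letter, if SubRun (windowAt f 0) x w (codes g) ∧
          (codes g).foldl push x = x then 1 else 0) =
        ∑ g : ZMod (m + 3) → Letter, if x = windowAt g 0 ∧ CyclicSub f g then 1 else 0 := by
      rintro k rfl
      refine Finset.sum_congr rfl fun g _ => ?_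
      have h1 : (codes g).foldl push x = windowAt (n := m + 3) g 0 :=
        foldl_cyclicCodes (m := m) hx g
      have h2 : SubRun (windowAt f 0) x w (codes g) ∧ (codes g).foldl push x = x ↔
          x = windowAt (n := m + 3) g 0 ∧ CyclicSub f g := by
        rw [h1]
        constructor
        · rintro ⟨h, h'⟩
          refine ⟨h'.symm, (subRun_cyclicCodes f g).1 ?_⟩
          rw [h', hw]; exact h
        · rintro ⟨h, h'⟩
          refine ⟨?_, h.symm⟩
          have := (subRun_cyclicCodes f g).2 h'
          rw [← h, hw] at this; exact this
      simp only [h2]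
    exact key _ hlen'
  have h1 : ((init (windowAt f 0)).subs.map fun t =>
      subCount (t % 16) (windowAt f 0) (t / 16) (cyclicCodes f)).sum =
      ((subWin (windowAt f 0)).map fun x =>
        ∑ g : ZMod (m + 3) → Letter, if x = windowAt g 0 ∧ CyclicSub f g then 1 else 0).sum := by
    rw [init, List.map_map]
    congr 1
    refine List.map_congr_left fun x hx => ?_
    have hx' := (mem_subWin.1 hx).1
    rw [← hcount x hx', Function.comp_apply, show (x + 16 * x) % 16 = x by omega,
      show (x + 16 * x) / 16 = x by omega]
  rw [h1, ← List.sum_toFinset _ (subWin_nodup _), Finset.sum_comm, Finset.card_filter]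
  refine Finset.sum_congr rfl fun g _ => ?_
  by_cases h : CyclicSub f g
  · simp [h, windowAt_mem_subWin h]
  · simp [h]

theorem cyclicSub_self {n : ℕ} (f : ZMod n → Letter) : CyclicSub f f := by
  intro i; simp [subOK]

theorem cyclicSub_noLetters {n : ℕ} (f : ZMod n → Letter) : CyclicSub f noLetters := by
  rw [← isClosedIn_edgeSet, edgeSet_noLetters]
  exact ⟨Set.empty_subset _, fun v a ha => absurd ha (Set.notMem_empty a)⟩

theorem not_cyclicDeg_noLetters {n : ℕ} : ¬ CyclicDeg (noLetters (n := n)) := by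
  intro h
  have h0 := h 0
  revert h0
  change ¬ degOK (windowCode false false false false) (Letter.code (false, false, false)) = true
  decide

-- The empty and the full word are always sub-selections, and the degree condition makes them
-- different; a count of two leaves no room for others.
open Classical in
theorem card_cyclicSub_eq_two_iff {n : ℕ} [NeZero n] {f : ZMod n → Letter} (hf : CyclicDeg f) :
    (Finset.univ.filter fun g : ZMod n → Letter => CyclicSub f g).card = 2 ↔
      ∀ g, CyclicSub f g → g = noLetters ∨ g = f := by
  have hne : noLetters ≠ f := by
    rintro rfl; exact not_cyclicDeg_noLetters hf
  have hsub : ({noLetters, f} : Finset (ZMod n → Letter)) ⊆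
      Finset.univ.filter fun g => CyclicSub f g := by
    intro g hg
    simp only [Finset.mem_insert, Finset.mem_singleton] at hg
    rw [Finset.mem_filter]
    rcases hg with rfl | rfl
    · exact ⟨Finset.mem_univ _, cyclicSub_noLetters f⟩
    · exact ⟨Finset.mem_univ _, cyclicSub_self _⟩
  constructor
  · intro h g hg
    have := Finset.eq_of_subset_of_card_le hsub (by rw [h, Finset.card_pair hne])
    have hg' : g ∈ Finset.univ.filter fun g => CyclicSub f g := by simp [hg]
    rw [← this] at hg'
    simpa using hg'
  · intro h
    rw [← Finset.card_pair hne]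
    congr 1
    refine (Finset.Subset.antisymm hsub fun g hg => ?_).symm
    have := h g (Finset.mem_filter.1 hg).2
    simpa using this

theorem completes_init_iff (h3 : (3 : ZMod (m + 3)) ≠ 0) {W : ℕ} (hW : W < 16)
    (f : ZMod (m + 3) → Letter) : (init W).Completes (cyclicCodes f) ↔
      W = windowAt f 0 ∧ IsHamiltonianCycle (m + 3) 3 (edgeSet f) := by
  classical
  rw [isHamiltonianCycle_edgeSet (by omega) h3, State.Completes]
  simp only [init, foldl_cyclicCodes hW]
  constructor
  · rintro ⟨h1, rfl, h2⟩
    rw [degRun_cyclicCodes] at h1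
    have := sum_init f
    simp only [init] at this
    rw [this, card_cyclicSub_eq_two_iff h1] at h2
    exact ⟨rfl, h1, h2⟩
  · rintro ⟨rfl, h1, h2⟩
    have := sum_init f
    simp only [init] at this
    rw [degRun_cyclicCodes, this, card_cyclicSub_eq_two_iff h1]
    exact ⟨h1, rfl, h2⟩

def initList (L : List ℕ) : List (State × ℤ) := L.map fun W => (init W, 1)

theorem total_initList (h3 : (3 : ZMod (m + 3)) ≠ 0) {L : List ℕ} (hL : ∀ W ∈ L, W < 16)
    (hL' : L.Nodup) : total (initList L) (m + 3) =
      ({C : Set (Edge (m + 3)) | IsHamiltonianCycle (m + 3) 3 C ∧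
        ∃ f, edgeSet f = C ∧ windowAt f 0 ∈ L}.ncard : ℤ) := by
  classical
  have h1 : {C : Set (Edge (m + 3)) | IsHamiltonianCycle (m + 3) 3 C ∧
      ∃ f, edgeSet f = C ∧ windowAt f 0 ∈ L} = edgeSet ''
        ((Finset.univ.filter fun f : ZMod (m + 3) → Letter =>
          windowAt f 0 ∈ L ∧ IsHamiltonianCycle (m + 3) 3 (edgeSet f) : Finset _) : Set _) := by
    ext C
    simp only [Set.mem_ofPred_eq, Set.mem_image, Finset.coe_filter, Finset.mem_univ, true_and]
    constructor
    · rintro ⟨h, f, rfl, hf⟩; exact ⟨f, ⟨hf, h⟩, rfl⟩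
    · rintro ⟨f, ⟨hf, h⟩, rfl⟩; exact ⟨h, f, rfl, hf⟩
  rw [h1, Set.ncard_image_of_injective _ edgeSet_injective, Set.ncard_coe_finset,
    Finset.card_filter, Nat.cast_sum, total, initList, List.map_map]
  have h2 : ∀ W ∈ L, ((fun p : State × ℤ => p.2 * p.1.count (m + 3)) ∘ fun W => (init W, 1)) W =
      ∑ f : ZMod (m + 3) → Letter,
        if W = windowAt f 0 ∧ IsHamiltonianCycle (m + 3) 3 (edgeSet f) then 1 else 0 := by
    intro W hW
    simp only [Function.comp_apply, one_mul, State.count]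
    refine Finset.sum_congr rfl fun f _ => ?_
    have : (init W).Completes (codes (n := m + 3) f) ↔ _ := completes_init_iff h3 (hL W hW) f
    simp only [this]
  rw [List.map_congr_left h2, ← List.sum_toFinset _ hL', Finset.sum_comm]
  refine Finset.sum_congr rfl fun f _ => ?_
  by_cases h : IsHamiltonianCycle (m + 3) 3 (edgeSet f) <;> simp [h]

/-! ### Seam edges and the parity of the start window -/

theorem seam_eq : seam (m + 3) 3 =
    {Edge.outer (-1), Edge.inner (-3), Edge.inner (-2), Edge.inner (-1)} := by
  have hval : ∀ (i : ZMod (m + 3)) (k l : ℕ), k + l = m + 3 → 0 < l →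
      (i = -(l : ZMod (m + 3)) ↔ i.val = k) := by
    intro i k l h hl
    rw [← natCast_eq_neg k l h]
    constructor
    · rintro rfl; exact ZMod.val_natCast_of_lt (by omega)
    · rintro rfl; exact (ZMod.natCast_zmod_val i).symm
  have h1 := fun i => hval i (m + 2) 1 rfl (by norm_num)
  have h2 := fun i => hval i (m + 1) 2 rfl (by norm_num)
  have h3 := fun i => hval i m 3 rfl (by norm_num)
  simp only [Nat.cast_one, Nat.cast_ofNat] at h1 h2 h3
  ext e
  cases e with
  | outer i =>
    have := i.val_lt
    simp [seam, h1]; omega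
  | inner i =>
    have := i.val_lt
    simp [seam, h1, h2, h3]; omega
  | spoke i => simp [seam]

theorem looseEnds_edgeSet (f : ZMod (m + 3) → Letter) :
    looseEnds 3 (edgeSet f) = (f (-1)).1.toNat + (f (-3)).2.1.toNat + (f (-2)).2.1.toNat +
      (f (-1)).2.1.toNat := by
  classical
  have h1 := one_ne_zero_of_two_le (n := m + 3) (by omega)
  have h2 : (2 : ZMod (m + 3)) ≠ 0 := by
    intro h
    have : ((2 : ℕ) : ZMod (m + 3)) = 0 := by exact_mod_cast h
    rw [ZMod.natCast_eq_zero_iff] at this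
    exact absurd (Nat.le_of_dvd (by norm_num) this) (by omega)
  have e1 : (-3 : ZMod (m + 3)) ≠ -2 := fun h => h1 (by linear_combination -h)
  have e2 : (-3 : ZMod (m + 3)) ≠ -1 := fun h => h2 (by linear_combination -h)
  have e3 : (-2 : ZMod (m + 3)) ≠ -1 := fun h => h1 (by linear_combination -h)
  have hs : edgeSet f ∩ seam (m + 3) 3 =
      ((({Edge.outer (-1), Edge.inner (-3), Edge.inner (-2), Edge.inner (-1)} :
        Finset (Edge (m + 3))).filter fun e => e ∈ edgeSet f : Finset _) : Set _) := by
    rw [seam_eq]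
    ext e
    simp only [Set.mem_inter_iff, Set.mem_insert_iff, Set.mem_singleton_iff, Finset.coe_filter,
      Finset.mem_insert, Finset.mem_singleton, Set.mem_ofPred_eq]
    exact and_comm
  rw [looseEnds, hs, Set.ncard_coe_finset, Finset.card_filter,
    Finset.sum_insert (by simp), Finset.sum_insert (by simp [e1, e2]),
    Finset.sum_insert (by simp [e3]), Finset.sum_singleton]
  simp only [outer_mem_edgeSet, inner_mem_edgeSet, Bool.toNat, add_assoc]
  cases (f (-1)).1 <;> cases (f (-3)).2.1 <;> cases (f (-2)).2.1 <;> cases (f (-1)).2.1 <;> rfl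

def evenWindows : List ℕ := [0, 3, 5, 6, 9, 10, 12, 15]

def oddWindows : List ℕ := [1, 2, 4, 7, 8, 11, 13, 14]

theorem windowCode_mem_evenWindows (p q r s : Bool) : windowCode p q r s ∈ evenWindows ↔
    Even (p.toNat + q.toNat + r.toNat + s.toNat) := by
  revert p q r s; decide

theorem windowCode_mem_oddWindows (p q r s : Bool) : windowCode p q r s ∈ oddWindows ↔
    Odd (p.toNat + q.toNat + r.toNat + s.toNat) := by
  revert p q r s; decide

theorem three_ne_zero_of_four_le {n : ℕ} (hn : 4 ≤ n) : (3 : ZMod n) ≠ 0 := by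
  intro h
  have : ((3 : ℕ) : ZMod n) = 0 := by exact_mod_cast h
  rw [ZMod.natCast_eq_zero_iff] at this
  exact absurd (Nat.le_of_dvd (by norm_num) this) (by omega)

/-- The bits of `windowAt f 0` record which seam edges are used, so even start windows are exactly
those with an even number of loose ends. The bound excludes `n = 3`, where inner edges are loops. -/
theorem hEven_eq_total {n : ℕ} (hn : 4 ≤ n) : (hEven 3 n : ℤ) = total (initList evenWindows) n := by
  obtain ⟨m, rfl⟩ := Nat.exists_eq_add_of_le' (show 3 ≤ n by omega)
  have h3 := three_ne_zero_of_four_le hn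
  rw [total_initList h3 (by decide) (by decide), hEven]
  congr 2
  ext C
  refine and_congr_right fun _ => ?_
  obtain ⟨f, rfl⟩ := edgeSet_surjective C
  have h : windowAt f 0 ∈ evenWindows ↔ Even (looseEnds 3 (edgeSet f)) := by
    rw [looseEnds_edgeSet, windowAt, windowCode_mem_evenWindows]; simp only [zero_sub]
  rw [← h]
  exact ⟨fun h => ⟨f, rfl, h⟩, fun ⟨g, hg, h⟩ => edgeSet_injective hg ▸ h⟩

theorem hOdd_eq_total {n : ℕ} (hn : 4 ≤ n) : (hOdd 3 n : ℤ) = total (initList oddWindows) n := by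
  obtain ⟨m, rfl⟩ := Nat.exists_eq_add_of_le' (show 3 ≤ n by omega)
  have h3 := three_ne_zero_of_four_le hn
  rw [total_initList h3 (by decide) (by decide), hOdd]
  congr 2
  ext C
  refine and_congr_right fun _ => ?_
  obtain ⟨f, rfl⟩ := edgeSet_surjective C
  have h : windowAt f 0 ∈ oddWindows ↔ Odd (looseEnds 3 (edgeSet f)) := by
    rw [looseEnds_edgeSet, windowAt, windowCode_mem_oddWindows]; simp only [zero_sub]
  rw [← h]
  exact ⟨fun h => ⟨f, rfl, h⟩, fun ⟨g, hg, h⟩ => edgeSet_injective hg ▸ h⟩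

/-! ### Small cases -/

instance {n : ℕ} [NeZero n] (f : ZMod n → Letter) : Decidable (CyclicDeg f) :=
  inferInstanceAs (Decidable (∀ i, degOK (windowAt f i) (f i).code = true))

instance {n : ℕ} [NeZero n] (f g : ZMod n → Letter) : Decidable (CyclicSub f g) :=
  inferInstanceAs (Decidable
    (∀ i, subOK (windowAt f i) (f i).code (windowAt g i) (g i).code = true))

/-- A cyclic word of length two. -/
def pairWord (p : Letter × Letter) : ZMod 2 → Letter := fun i => bif decide (i = 0) then p.1 else p.2

theorem pairWord_eta (f : ZMod 2 → Letter) : pairWord (f 0, f 1) = f := by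
  funext i
  have : i = 0 ∨ i = 1 := by revert i; decide
  rcases this with rfl | rfl <;> rfl

theorem pairWord_injective : Function.Injective pairWord := by
  intro p q h
  exact Prod.ext (congrFun h 0) (congrFun h 1)

theorem ncard_of_pairWord (S : Finset (Letter × Letter)) {T : Set (Set (Edge 2))}
    (h : ∀ p, edgeSet (pairWord p) ∈ T ↔ p ∈ S) : T.ncard = S.card := by
  have : T = (edgeSet ∘ pairWord) '' (S : Set (Letter × Letter)) := by
    ext C
    obtain ⟨f, rfl⟩ := edgeSet_surjective C
    rw [← pairWord_eta f, h]
    exact ((edgeSet_injective.comp pairWord_injective).mem_set_image (s := S)).symm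
  rw [this, Set.ncard_image_of_injective _ (edgeSet_injective.comp pairWord_injective),
    Set.ncard_coe_finset]

theorem looseEnds_two (f : ZMod 2 → Letter) :
    looseEnds 3 (edgeSet f) = (f 1).1.toNat + (f 0).2.1.toNat + (f 1).2.1.toNat := by
  classical
  have h1 : ∀ i : ZMod 2, 2 ≤ i.val + 1 ↔ i = 1 := by decide
  -- As `3 ≥ 2`, both inner edges pass the seam.
  have h2 : ∀ i : ZMod 2, 2 ≤ i.val + 3 ↔ (i = 0 ∨ i = 1) := by decide
  have hseam : seam 2 3 = {Edge.outer 1, Edge.inner 0, Edge.inner 1} := by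
    ext e
    cases e with
    | outer i => simpa [seam] using h1 i
    | inner i => simpa [seam] using h2 i
    | spoke i => simp [seam]
  have hs : edgeSet f ∩ seam 2 3 =
      ((({Edge.outer 1, Edge.inner 0, Edge.inner 1} :
        Finset (Edge 2)).filter fun e => e ∈ edgeSet f : Finset _) : Set _) := by
    rw [hseam]
    ext e
    simp only [Set.mem_inter_iff, Set.mem_insert_iff, Set.mem_singleton_iff, Finset.coe_filter,
      Finset.mem_insert, Finset.mem_singleton, Set.mem_ofPred_eq]
    exact and_comm
  rw [looseEnds, hs, Set.ncard_coe_finset, Finset.card_filter,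
    Finset.sum_insert (by simp), Finset.sum_insert (by simp), Finset.sum_singleton]
  simp only [outer_mem_edgeSet, inner_mem_edgeSet, Bool.toNat, add_assoc]
  cases (f 1).1 <;> cases (f 0).2.1 <;> cases (f 1).2.1 <;> rfl

/-- The Hamiltonian cycles of `G(2, 3)`. -/
def wordsTwo : List (Letter × Letter) :=
  [((true, true, true), (false, false, true)), ((true, false, true), (false, true, true)),
    ((false, true, true), (true, false, true)), ((false, false, true), (true, true, true))]

set_option synthInstance.maxSize 1000 in
-- Since `3 ≠ 0` modulo 2, the criterion for words still applies, and there are only 64 words to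
-- check.
theorem isHamiltonianCycle_two (p : Letter × Letter) :
    IsHamiltonianCycle 2 3 (edgeSet (pairWord p)) ↔ p ∈ wordsTwo := by
  rw [isHamiltonianCycle_edgeSet le_rfl (by decide)]
  have key : ∀ p : Letter × Letter, (CyclicDeg (pairWord p) ∧ ∀ q : Letter × Letter,
      CyclicSub (pairWord p) (pairWord q) →
        q = ((false, false, false), (false, false, false)) ∨ q = p) ↔ p ∈ wordsTwo := by
    decide +kernel
  have h0 : (noLetters : ZMod 2 → Letter) =
      pairWord ((false, false, false), (false, false, false)) := by
    rw [← pairWord_eta noLetters]; rfl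
  rw [← key, h0]
  refine and_congr_right fun _ => ⟨fun h q hq => ?_, fun h g hg => ?_⟩
  · exact (h _ hq).imp (fun h => pairWord_injective h) (fun h => pairWord_injective h)
  · rw [← pairWord_eta g] at hg ⊢
    exact (h _ hg).imp (congrArg _) (congrArg _)

theorem hEven_two : hEven 3 2 = 2 := by
  refine ncard_of_pairWord {((false, true, true), (true, false, true)),
    ((false, false, true), (true, true, true))} fun p => ?_
  rw [Set.mem_ofPred_eq, isHamiltonianCycle_two, looseEnds_two]
  revert p
  decide +kernel

theorem hOdd_two : hOdd 3 2 = 2 := by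
  refine ncard_of_pairWord {((true, true, true), (false, false, true)),
    ((true, false, true), (false, true, true))} fun p => ?_
  rw [Set.mem_ofPred_eq, isHamiltonianCycle_two, looseEnds_two]
  revert p
  decide +kernel

/-- The inner edges are loops, so a walk would have to enter and leave `w_0` by the same spoke,
which identifies two distinct positions. -/
theorem not_isHamiltonianCycle_three (C : Set (Edge 3)) : ¬ IsHamiltonianCycle 3 3 C := by
  rintro ⟨x, e, hx, he, -⟩
  have hspoke : ∀ i, Vertex.w 0 ∈ ends 3 (e i) → e i = .spoke 0 := by
    intro i hi
    have hne : ¬ (ends 3 (e i)).IsDiag := by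
      rw [he, Sym2.mk_isDiag_iff, hx.1.eq_iff]
      have : ∀ i : ZMod (2 * 3), ¬ i = i + 1 := by decide
      exact this i
    rw [w_mem_ends] at hi
    rcases hi with h | h | h
    · rw [h] at hne; exact absurd (by simp [ends]; decide) hne
    · rw [h] at hne; exact absurd (by simp [ends]; decide) hne
    · exact h
  obtain ⟨i, hi⟩ := hx.2 (Vertex.w 0)
  have h1 : e i = .spoke 0 := hspoke i (by rw [he, hi]; simp)
  have h2 : e (i - 1) = .spoke 0 := hspoke (i - 1) (by rw [he, sub_add_cancel, hi]; simp)
  have h3 := he i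
  rw [h1, ← h2, he, sub_add_cancel, Sym2.eq_swap, Sym2.congr_right, hx.1.eq_iff] at h3
  have : ∀ i : ZMod (2 * 3), i - 1 ≠ i + 1 := by decide
  exact this i h3

theorem hEven_three : hEven 3 3 = 0 := by
  simp [hEven, not_isHamiltonianCycle_three]

theorem hOdd_three : hOdd 3 3 = 0 := by
  simp [hOdd, not_isHamiltonianCycle_three]

/-- Outer and inner edges are loops, so both steps of the walk use the spoke. The edge set then has
degree one at each vertex, outside the reach of the two-factor criterion. -/
theorem isHamiltonianCycle_one (C : Set (Edge 1)) :
    IsHamiltonianCycle 1 3 C ↔ C = {Edge.spoke 0} := by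
  constructor
  · rintro ⟨x, e, hx, he, rfl⟩
    have h : ∀ i, e i = .spoke 0 := by
      intro i
      have hne : ¬ (ends 3 (e i)).IsDiag := by
        rw [he, Sym2.mk_isDiag_iff, hx.1.eq_iff]
        revert i; decide
      cases h : e i with
      | outer j => rw [h] at hne; exact absurd (by simp [ends]; exact Subsingleton.elim _ _) hne
      | inner j => rw [h] at hne; exact absurd (by simp [ends]; exact Subsingleton.elim _ _) hne
      | spoke j => rw [Subsingleton.elim j 0]
    ext a
    simp only [Set.mem_range, h, Set.mem_singleton_iff, eq_comm]
    exact ⟨fun ⟨_, h⟩ => h, fun h => ⟨0, h⟩⟩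
  · rintro rfl
    let x : ZMod (2 * 1) → Vertex 1 := fun i => bif decide (i = 0) then .v 0 else .w 0
    refine ⟨x, fun _ => .spoke 0, ⟨?_, ?_⟩, ?_, ?_⟩
    · intro i j
      have hi : i = 0 ∨ i = 1 := by revert i; decide
      have hj : j = 0 ∨ j = 1 := by revert j; decide
      rcases hi with rfl | rfl <;> rcases hj with rfl | rfl <;> intro h
      · rfl
      · cases h
      · cases h
      · rfl
    · rintro (j | j)
      · exact ⟨0, by rw [Subsingleton.elim j 0]; rfl⟩
      · exact ⟨1, by rw [Subsingleton.elim j 0]; rfl⟩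
    · intro i
      have hi : i = 0 ∨ i = 1 := by revert i; decide
      rcases hi with rfl | rfl
      · rfl
      · exact Sym2.eq_swap
    · ext a; simp

theorem looseEnds_one : looseEnds 3 ({Edge.spoke 0} : Set (Edge 1)) = 0 := by
  have : ({Edge.spoke 0} : Set (Edge 1)) ∩ seam 1 3 = ∅ := by
    ext a
    simp only [Set.mem_inter_iff, Set.mem_singleton_iff, Set.mem_empty_iff_false, iff_false]
    rintro ⟨rfl, h⟩
    exact h
  rw [looseEnds, this, Set.ncard_empty]

theorem hEven_one : hEven 3 1 = 1 := by
  have : {C : Set (Edge 1) | IsHamiltonianCycle 1 3 C ∧ Even (looseEnds 3 C)} =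
      {{Edge.spoke 0}} := by
    ext C
    simp only [Set.mem_ofPred_eq, isHamiltonianCycle_one, Set.mem_singleton_iff]
    refine ⟨fun h => h.1, ?_⟩
    rintro rfl
    exact ⟨rfl, by rw [looseEnds_one]; exact Even.zero⟩
  rw [hEven, this, Set.ncard_singleton]

theorem hOdd_one : hOdd 3 1 = 0 := by
  have : {C : Set (Edge 1) | IsHamiltonianCycle 1 3 C ∧ Odd (looseEnds 3 C)} = ∅ := by
    ext C
    simp only [Set.mem_ofPred_eq, isHamiltonianCycle_one, Set.mem_empty_iff_false, iff_false]
    rintro ⟨rfl, h⟩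
    rw [looseEnds_one] at h
    exact absurd h (by decide)
  rw [hOdd, this, Set.ncard_empty]

/-! ### Linear recurrences -/

theorem combination_congr {q : List ℤ} {u v : ℕ → ℤ} (h : ∀ k < q.length, u k = v k) :
    combination q u = combination q v := by
  induction q generalizing u v with
  | nil => rfl
  | cons c q ih =>
    rw [combination, combination, h 0 (by simp),
      ih fun k hk => h (k + 1) (by simpa using hk)]

theorem combination_sub (q : List ℤ) (u v : ℕ → ℤ) :
    (combination q fun k => u k - v k) = combination q u - combination q v := by
  induction q generalizing u v with
  | nil => simp [combination]
  | cons c q ih => simp only [combination, ih]; ring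

theorem combination_add (q : List ℤ) (u v : ℕ → ℤ) :
    (combination q fun k => u k + v k) = combination q u + combination q v := by
  induction q generalizing u v with
  | nil => simp [combination]
  | cons c q ih => simp only [combination, ih]; ring

theorem combination_smul (q : List ℤ) (c : ℤ) (u : ℕ → ℤ) :
    (combination q fun k => c * u k) = c * combination q u := by
  induction q generalizing u with
  | nil => simp [combination]
  | cons c q ih => simp only [combination, ih]; ring

theorem combination_replicate_append (k : ℕ) (q : List ℤ) (u : ℕ → ℤ) :
    combination (List.replicate k 0 ++ q) u = combination q fun j => u (j + k) := by
  induction k generalizing u with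
  | zero => rfl
  | succ k ih =>
    rw [List.replicate_succ, List.cons_append, combination, ih, zero_mul, zero_add]
    rfl

theorem combination_append_replicate (k : ℕ) (q : List ℤ) (u : ℕ → ℤ) :
    combination (q ++ List.replicate k 0) u = combination q u := by
  induction q generalizing u with
  | nil =>
    have := combination_replicate_append k [] u
    rwa [List.append_nil] at this
  | cons c q ih => rw [List.cons_append, combination, ih, combination]

theorem combination_zipWith_sub {p q : List ℤ} (h : p.length = q.length) (u : ℕ → ℤ) :
    combination (List.zipWith (· - ·) p q) u = combination p u - combination q u := by
  induction p generalizing q u with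
  | nil => cases q <;> simp_all [combination]
  | cons a p ih =>
    cases q with
    | nil => simp at h
    | cons b q =>
      rw [List.zipWith_cons_cons, combination, ih (by simpa using h), combination, combination]
      ring

theorem combination_eq_sum (q : List ℤ) (u : ℕ → ℤ) :
    combination q u = ∑ j ∈ Finset.range q.length, q.getD j 0 * u j := by
  induction q generalizing u with
  | nil => simp [combination]
  | cons c q ih =>
    rw [combination, ih, List.length_cons, Finset.sum_range_succ']
    simp [add_comm]

/-- The coefficients of `x⁴ (x¹² - 1) p`, from those of `p`. -/
def periodicMultiple (q : List ℤ) : List ℤ :=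
  List.replicate 4 0 ++ List.zipWith (· - ·) (List.replicate 12 0 ++ q) (q ++ List.replicate 12 0)

theorem combination_periodicMultiple (q : List ℤ) (u : ℕ → ℤ) :
    combination (periodicMultiple q) u =
      (combination q fun j => u (j + 16)) - combination q fun j => u (j + 4) := by
  rw [periodicMultiple, combination_replicate_append, combination_zipWith_sub
      (by rw [List.length_append, List.length_append, add_comm]),
    combination_replicate_append, combination_append_replicate]

/-- If `F` satisfies the recurrence with characteristic polynomial `(x¹² - 1) p` from `4` on and
`w` has period `12`, then `F - w` satisfies the one for `p`, if its first instances hold. -/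
theorem combination_eq_zero_of_periodic {q : List ℤ} {F w : ℕ → ℤ} {a : ℕ} (ha : a ≤ 4)
    (hF : ∀ n, (combination (periodicMultiple q) fun k => F (n + k)) = 0)
    (hw : ∀ n, w (n + 12) = w n)
    (hinit : ∀ m, a ≤ m → m < 16 → (combination q fun k => F (m + k) - w (m + k)) = 0)
    (m : ℕ) (hm : a ≤ m) : (combination q fun k => F (m + k) - w (m + k)) = 0 := by
  induction m using Nat.strong_induction_on with
  | _ m ih =>
    rcases Nat.lt_or_ge m 16 with h | h
    · exact hinit m hm h
    obtain ⟨n, rfl⟩ := Nat.exists_eq_add_of_le' h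
    -- Here `m = n + 16`, and `hF n` equates the instances for `F` at `n + 16` and `n + 4`. The
    -- latter is twelve below `m` and at least `a` because `a ≤ 4`.
    have h1 := ih (n + 4) (by omega) (by omega)
    have h2 := hF n
    rw [combination_periodicMultiple] at h2
    rw [combination_sub] at h1 ⊢
    have e1 : (combination q fun k => w (n + 16 + k)) = combination q fun k => w (n + 4 + k) :=
      congrArg _ (funext fun k => by rw [← hw (n + 4 + k)]; congr 1; ring)
    have e2 : (combination q fun k => F (n + 16 + k)) = combination q fun k => F (n + (k + 16)) :=
      congrArg _ (funext fun k => by congr 1; ring)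
    have e3 : (combination q fun k => F (n + 4 + k)) = combination q fun k => F (n + (k + 4)) :=
      congrArg _ (funext fun k => by congr 1; ring)
    rw [e1, e2]
    rw [e3] at h1
    linarith

/-! ### The finite certificates -/

theorem total_initList_cons (W : ℕ) (L : List ℕ) (n : ℕ) :
    total (initList (W :: L)) n = total [(init W, 1)] n + total (initList L) n := by
  simp [total, initList]

/-- The polynomial annihilates each start window separately; the relations are then added. -/
theorem combination_total_eq_zero {q : List ℤ} {L : List ℕ}
    (h : (L.all fun W => isZero (combine q [(init W, 1)] [])) = true) (n : ℕ) :
    (combination q fun k => total (initList L) (n + k)) = 0 := by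
  induction L with
  | nil =>
    have := combination_smul q 0 fun _ => 0
    simpa [initList, total] using this
  | cons W L ih =>
    rw [List.all_cons, Bool.and_eq_true] at h
    simp only [total_initList_cons]
    rw [combination_add, ih h.2, add_zero]
    have := total_of_isZero h.1 n
    rw [total_combine] at this
    simpa [total] using this

/-- The values `total (initList L) 0, …, total (initList L) (k - 1)`. -/
def valueTable (k : ℕ) (L : List ℕ) : List ℤ :=
  L.foldr (fun W M => List.zipWith (· + ·) (values k [(init W, 1)]) M) (List.replicate k 0)

theorem valueTable_eq (k : ℕ) (L : List ℕ) :
    valueTable k L = (List.range k).map (total (initList L)) := by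
  induction L with
  | nil =>
    refine List.ext_getElem (by simp [valueTable]) fun j h1 h2 => ?_
    simp [valueTable, initList, total]
  | cons W L ih =>
    have : valueTable k (W :: L) =
      List.zipWith (· + ·) (values k [(init W, 1)]) (valueTable k L) := rfl
    rw [this, ih, values_eq]
    refine List.ext_getElem (by simp) fun j h1 h2 => ?_
    simp [total_initList_cons]

/-- Constant term first, as `combination` reads coefficients. -/
def coeffsAlpha : List ℤ := [1, 2, 1, 2, 2, 0, -1, -2, 0, -2, 0, 0, 1]

def coeffsBeta : List ℤ := [-1, 0, -2, 0, -1, 0, 1, 0, -1, 0, 0, 0, -1, 0, 1]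

/-- Indexed from `n = 0`. Instances `m < 16` of a recurrence of order 12 reach index 27, hence 28
entries; likewise order 14 requires 30 entries in `oddTable`. -/
def evenTable : List ℤ :=
  [0, 0, 2, 0, 0, 0, 8, 7, 0, 9, 12, 11, 36, 26, 30, 75, 64, 102, 182, 152, 260, 399, 398, 667,
    888, 975, 1588, 1998]

def oddTable : List ℤ :=
  [4, 0, 2, 0, 6, 0, 8, 0, 6, 0, 12, 0, 32, 0, 58, 0, 86, 0, 134, 0, 176, 0, 266, 0, 464, 0, 756,
    0, 1210, 0]

set_option maxRecDepth 100000 in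
theorem even_computation : valueTable 28 evenWindows = evenTable ∧
    (evenWindows.all fun W =>
      isZero (combine (periodicMultiple coeffsAlpha) [(init W, 1)] [])) = true := by
  decide +kernel

set_option maxRecDepth 100000 in
theorem odd_computation : valueTable 30 oddWindows = oddTable ∧
    (oddWindows.all fun W =>
      isZero (combine (periodicMultiple coeffsBeta) [(init W, 1)] [])) = true := by
  decide +kernel

/-! ### The sequences -/

theorem getD_range_map (u : ℕ → ℤ) {n k : ℕ} (h : n < k) :
    ((List.range k).map u).getD n 0 = u n := by
  rw [List.getD_eq_getElem _ _ (by simpa using h)]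
  simp

theorem total_even {n : ℕ} (h : n < 28) : total (initList evenWindows) n = evenTable.getD n 0 := by
  rw [← even_computation.1, valueTable_eq, getD_range_map _ h]

theorem total_odd {n : ℕ} (h : n < 30) : total (initList oddWindows) n = oddTable.getD n 0 := by
  rw [← odd_computation.1, valueTable_eq, getD_range_map _ h]

/-- The correction at `n = 1` is the cycle `v_0 w_0 v_0`, which uses its spoke twice and is
invisible to the automaton. -/
theorem hEven_eq {n : ℕ} (hn : 1 ≤ n) :
    (hEven 3 n : ℤ) = total (initList evenWindows) n + if n = 1 then 1 else 0 := by
  rcases Nat.lt_or_ge n 4 with h | h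
  · rw [total_even (by omega)]
    interval_cases n
    · rw [hEven_one]; rfl
    · rw [hEven_two]; rfl
    · rw [hEven_three]; rfl
  · rw [hEven_eq_total h, if_neg (by omega), add_zero]

theorem hOdd_eq {n : ℕ} (hn : 1 ≤ n) : (hOdd 3 n : ℤ) = total (initList oddWindows) n := by
  rcases Nat.lt_or_ge n 4 with h | h
  · rw [total_odd (by omega)]
    interval_cases n
    · rw [hOdd_one]; rfl
    · rw [hOdd_two]; rfl
    · rw [hOdd_three]; rfl
  · exact hOdd_eq_total h

theorem hAlpha_eq {n : ℕ} (hn : 1 ≤ n) (hn' : n < 28) :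
    hAlpha n = evenTable.getD n 0 + (if n = 1 then 1 else 0) - uEven n := by
  rw [hAlpha, hEven_eq hn, total_even hn']

theorem hBeta_eq {n : ℕ} (hn : 1 ≤ n) (hn' : n < 30) :
    hBeta n = oddTable.getD n 0 - uOdd n := by
  rw [hBeta, hOdd_eq hn, total_odd hn']

theorem uEven_add_twelve (n : ℕ) : uEven (n + 12) = uEven n := by
  unfold uEven; rw [show (n + 12) % 4 = n % 4 by omega]

theorem uOdd_add_twelve (n : ℕ) : uOdd (n + 12) = uOdd n := by
  unfold uOdd; rw [Nat.add_mod_right]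

theorem combination_hAlpha (m : ℕ) (hm : 1 ≤ m) :
    (combination coeffsAlpha fun k => hAlpha (m + k)) = 0 := by
  -- Only the instance `m = 1` involves the value at `n = 1`, where the automaton needs its
  -- correction; it is checked directly.
  rcases Nat.lt_or_ge m 2 with h | h
  · have h1 : (combination coeffsAlpha fun k => hAlpha (m + k)) = combination coeffsAlpha fun k =>
        evenTable.getD (m + k) 0 + (if m + k = 1 then 1 else 0) - uEven (m + k) := by
      refine combination_congr fun k hk => hAlpha_eq (by omega) ?_
      have : coeffsAlpha.length = 13 := rfl
      omega
    rw [h1]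
    interval_cases m
    decide +kernel
  · have h1 := combination_eq_zero_of_periodic (q := coeffsAlpha) (a := 2) (by norm_num)
      (F := total (initList evenWindows)) (w := uEven)
      (combination_total_eq_zero even_computation.2) uEven_add_twelve (fun m hm hm' => ?_) m h
    · rw [← h1]
      refine combination_congr fun k _ => ?_
      rw [hAlpha, hEven_eq (by omega), if_neg (by omega), add_zero]
    · have h2 : (combination coeffsAlpha fun k =>
          total (initList evenWindows) (m + k) - uEven (m + k)) =
          combination coeffsAlpha fun k => evenTable.getD (m + k) 0 - uEven (m + k) := by
        refine combination_congr fun k hk => ?_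
        have : coeffsAlpha.length = 13 := rfl
        rw [total_even (by omega)]
      rw [h2]
      have key : ∀ m < 16, 2 ≤ m → (combination coeffsAlpha fun k =>
          evenTable.getD (m + k) 0 - uEven (m + k)) = 0 := by decide +kernel
      exact key m hm' hm

theorem combination_hBeta (m : ℕ) (hm : 1 ≤ m) :
    (combination coeffsBeta fun k => hBeta (m + k)) = 0 := by
  have h1 := combination_eq_zero_of_periodic (q := coeffsBeta) (a := 1) (by norm_num)
    (F := total (initList oddWindows)) (w := uOdd)
    (combination_total_eq_zero odd_computation.2) uOdd_add_twelve (fun m hm hm' => ?_) m hm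
  · rw [← h1]
    refine combination_congr fun k _ => ?_
    rw [hBeta, hOdd_eq (by omega)]
  · have h2 : (combination coeffsBeta fun k => total (initList oddWindows) (m + k) - uOdd (m + k)) =
        combination coeffsBeta fun k => oddTable.getD (m + k) 0 - uOdd (m + k) := by
      refine combination_congr fun k hk => ?_
      have : coeffsBeta.length = 15 := rfl
      rw [total_odd (by omega)]
    rw [h2]
    have key : ∀ m < 16, 1 ≤ m → (combination coeffsBeta fun k =>
        oddTable.getD (m + k) 0 - uOdd (m + k)) = 0 := by decide +kernel
    exact key m hm' hm

/-! ### Coefficient lists as polynomials -/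

/-- The polynomial with the given coefficients. -/
noncomputable def ofCoeffs (q : List ℤ) : ℤ[X] := q.foldr (fun c p => C c + X * p) 0

theorem coeff_ofCoeffs (q : List ℤ) (j : ℕ) : (ofCoeffs q).coeff j = q.getD j 0 := by
  induction q generalizing j with
  | nil => simp [ofCoeffs]
  | cons c q ih =>
    have : ofCoeffs (c :: q) = C c + X * ofCoeffs q := rfl
    rw [this, coeff_add]
    cases j with
    | zero => simp
    | succ j => rw [coeff_C_succ, zero_add, coeff_X_mul, ih, List.getD_cons_succ]

theorem isCharPolyFrom_of_combination {p : ℤ[X]} {q : List ℤ} (hp : p = ofCoeffs q)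
    (hm : p.Monic) (hq : q.length = p.natDegree + 1) {u : ℕ → ℤ}
    (h : ∀ m, 1 ≤ m → (combination q fun k => u (m + k)) = 0) :
    IsCharPolyFrom p u (p.natDegree + 1) := by
  refine ⟨hm, fun m hm' => ?_⟩
  rw [← h m (by omega), combination_eq_sum, hq]
  refine Finset.sum_congr rfl fun j _ => ?_
  rw [← coeff_ofCoeffs, ← hp]

theorem P7_sq_eq : P7 ^ 2 = ofCoeffs coeffsAlpha := by
  simp only [P7, ofCoeffs, coeffsAlpha, List.foldr_cons, List.foldr_nil, map_neg, map_one,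
    map_zero, map_ofNat]
  ring

theorem P8_eq : P8 = ofCoeffs coeffsBeta := by
  simp only [P8, ofCoeffs, coeffsBeta, List.foldr_cons, List.foldr_nil, map_neg, map_one,
    map_zero, map_ofNat]
  ring

theorem P7_monic : P7.Monic := by unfold P7; monicity!

theorem P8_monic : P8.Monic := by unfold P8; monicity!

theorem natDegree_P7_sq : (P7 ^ 2).natDegree = 12 := by
  have : P7.natDegree = 6 := by unfold P7; compute_degree!
  rw [P7_monic.natDegree_pow, this]

theorem natDegree_P8 : P8.natDegree = 14 := by unfold P8; compute_degree!

theorem isCharPolyFrom_hAlpha : IsCharPolyFrom (P7 ^ 2) hAlpha 13 := by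
  have := isCharPolyFrom_of_combination P7_sq_eq (P7_monic.pow 2)
    (by rw [natDegree_P7_sq]; rfl) combination_hAlpha
  rwa [natDegree_P7_sq] at this

theorem isCharPolyFrom_hBeta : IsCharPolyFrom P8 hBeta 15 := by
  have := isCharPolyFrom_of_combination P8_eq P8_monic
    (by rw [natDegree_P8]; rfl) combination_hBeta
  rwa [natDegree_P8] at this

theorem h_eq_hEven_add_hOdd {n : ℕ} (k : ℕ) (hn : 1 ≤ n) : h k n = hEven k n + hOdd k n := by
  have : NeZero n := ⟨by omega⟩
  rw [h, hEven, hOdd, ← Set.ncard_union_eq _ (Set.toFinite _) (Set.toFinite _)]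
  · congr 1
    ext C
    have := Nat.even_or_odd (looseEnds k C)
    simp only [Set.mem_ofPred_eq, Set.mem_union]
    tauto
  · rw [Set.disjoint_left]
    rintro C ⟨_, h1⟩ ⟨_, h2⟩
    exact (Nat.not_even_iff_odd.2 h2) h1

end GenPetersen

theorem mainTheorem2 :
    (∀ n : ℕ, 1 ≤ n →
      (GenPetersen.h 3 n : ℤ) =
        GenPetersen.hAlpha n + GenPetersen.hBeta n + GenPetersen.hGamma n) ∧
    ((∀ i : Fin 12, GenPetersen.hAlpha (i.val + 1) =
        (![1, 0, 0, 0, 0, 6, 7, 0, 9, 10, 11, 36] : Fin 12 → ℤ) i) ∧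
      GenPetersen.IsCharPolyFrom (GenPetersen.P7 ^ 2) GenPetersen.hAlpha 13) ∧
    ((∀ i : Fin 14, GenPetersen.hBeta (i.val + 1) =
        (![0, 2, 0, 2, 0, 8, 0, 2, 0, 12, 0, 44, 0, 58] : Fin 14 → ℤ) i) ∧
      GenPetersen.IsCharPolyFrom GenPetersen.P8 GenPetersen.hBeta 15) ∧
    ((∀ i : Fin 12, GenPetersen.hGamma (i.val + 1) =
        (![0, 2, 0, 4, 0, 2, 0, 4, 0, 2, 0, -12] : Fin 12 → ℤ) i) ∧
      ∀ n : ℕ, 1 ≤ n → GenPetersen.hGamma (n + 12) = GenPetersen.hGamma n) := by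
  refine ⟨fun n hn => ?_, ⟨fun i => ?_, GenPetersen.isCharPolyFrom_hAlpha⟩,
    ⟨fun i => ?_, GenPetersen.isCharPolyFrom_hBeta⟩, by decide, fun n _ => ?_⟩
  · rw [GenPetersen.h_eq_hEven_add_hOdd 3 hn, GenPetersen.hAlpha, GenPetersen.hBeta,
      GenPetersen.hGamma]
    push_cast
    ring
  · rw [GenPetersen.hAlpha_eq (by omega) (by omega)]
    revert i
    decide +kernel
  · rw [GenPetersen.hBeta_eq (by omega) (by omega)]
    revert i
    decide +kernel
  · rw [GenPetersen.hGamma, GenPetersen.hGamma, GenPetersen.uEven_add_twelve,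
      GenPetersen.uOdd_add_twelve]
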